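/- For linear subspaces $P,Q\subset\mathbb R^{n+m}$ with orthogonal projections $\mathcal P,\mathcal Q$ and $\theta\in[0,\pi/2]$, put $P_\theta=\{u\in P:\ \mathcal P\mathcal Q u=\cos^2\theta\,u\}$. The number $\theta$ is a Jordan angle between $P$ and $Q$, written $\theta\in\mathrm{Arg}(P,Q)$, if $P_\theta\neq 0$; its multiplicity is $\dim P_\theta$. Let $M^n$ be a connected smooth $n$-dimensional (immersed) submanifold of $\mathbb R^{n+m}$, not necessarily complete, with tangent planes $T_pM$ and normal planes $N_pM=(T_pM)^\perp$, and let $Q_0\subset\mathbb R^{n+m}$ be a fixed $m$-dimensional linear subspace. Suppose that $M$ has constant Jordan angles (CJA) relative to $Q_0$: the set $\mathrm{Arg}(N_pM,Q_0)$ and the multiplicity of each of its elements do not depend on $p\in M$. (Then $\mathrm{Arg}(T_pM,Q_0^\perp)$ does not depend on $p$ either.) Let $\mathrm{Arg}^N=\mathrm{Arg}(N_pM,Q_0)$, $\mathrm{Arg}^T=\mathrm{Arg}(T_pM,Q_0^\perp)$, $g^N=|\mathrm{Arg}^N|$, $g^T=|\mathrm{Arg}^T|$. Let $B_{XY}=(\overline\nabla_XY)^N$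 be the second fundamental form, where $\overline\nabla$ is the flat connection of $\mathbb R^{n+m}$, and $H=\operatorname{tr}B$ the mean curvature vector field. $M$ is minimal if $H\equiv0$, and has parallel mean curvature if $(\overline\nabla_XH)^N=0$ for every tangent vector $X$. Then $M$ is affine linear, i.e. (its image is) a relatively open subset of an $n$-dimensional affine subspace of $\mathbb R^{n+m}$, in each of the following cases: (i) $g^T=g^N=1$; (ii) $g^T=1$, $g^N=2$, $\pi/2\notin\mathrm{Arg}^T$, and $M$ has parallel mean curvature; (iii) $g^T=2$, $g^N=1$, $\pi/2\notin\mathrm{Arg}^N$, and $M$ has parallel mean curvature; (iv) $g^T=g^N=2$, $\mathrm{Arg}^N\neq\{0,\pi/2\}$, and $M$ is minimal. -/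

import Mathlib

open Module
open scoped Manifold ContDiff InnerProductSpace

noncomputable section

/-- The standard Euclidean space `ℝ^k`. -/
abbrev Euc (k : ℕ) : Type := EuclideanSpace ℝ (Fin k)

/-! Jordan angles between two linear subspaces of Euclidean space. -/

/-- The angle space `P_θ` of `P` relative to `Q`: all `u ∈ P` with `(𝒫_P ∘ 𝒫_Q) u = cos² θ • u`,
where `𝒫_P`, `𝒫_Q` are the orthogonal projections onto `P`, `Q`. -/
def angleSpace {k : ℕ} (P Q : Submodule ℝ (Euc k)) (θ : ℝ) : Submodule ℝ (Euc k) where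
  carrier := {u | u ∈ P ∧ P.starProjection (Q.starProjection u) = Real.cos θ ^ 2 • u}
  zero_mem' := by simp
  add_mem' := by
    rintro u v ⟨hu, hu'⟩ ⟨hv, hv'⟩
    exact ⟨P.add_mem hu hv, by rw [map_add, map_add, hu', hv', smul_add]⟩
  smul_mem' := by
    rintro c u ⟨hu, hu'⟩
    exact ⟨P.smul_mem c hu, by rw [map_smul, map_smul, hu', smul_comm]⟩

/-- `Arg(P, Q)`: the Jordan angles between `P` and `Q`, i.e. the `θ ∈ [0, π/2]` such that `cos² θ`
is an eigenvalue of the operator `𝒫_P ∘ 𝒫_Q` on `P`. -/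
def jordanAngles {k : ℕ} (P Q : Submodule ℝ (Euc k)) : Set ℝ :=
  {θ | θ ∈ Set.Icc 0 (Real.pi / 2) ∧ angleSpace P Q θ ≠ ⊥}

/-- The multiplicity of the Jordan angle `θ` between `P` and `Q`. -/
def jordanMultiplicity {k : ℕ} (P Q : Submodule ℝ (Euc k)) (θ : ℝ) : ℕ :=
  finrank ℝ (angleSpace P Q θ)

/-! Submanifolds of Euclidean space, given by a smooth immersion `F` of an abstract smooth manifold
`M` (for a submanifold `M ⊆ ℝ^k`, the inclusion). -/

section Submanifold

variable (n : ℕ) {k : ℕ} {M : Type*} [TopologicalSpace M] [ChartedSpace (Euc n) M]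

/-- The differential of `F` at `p`. -/
def differentialAt (F : M → Euc k) (p : M) : TangentSpace (𝓡 n) p →ₗ[ℝ] Euc k :=
  (mfderiv (𝓡 n) 𝓘(ℝ, Euc k) F p).toLinearMap

/-- `F` is a smooth immersion. -/
def IsSmoothImmersion (F : M → Euc k) : Prop :=
  ContMDiff (𝓡 n) 𝓘(ℝ, Euc k) ∞ F ∧
    ∀ p : M, Function.Injective (differentialAt n F p)

/-- The tangent plane `T_p M`, as a linear subspace of the ambient space. -/
def tangentPlane (F : M → Euc k) (p : M) : Submodule ℝ (Euc k) :=
  LinearMap.range (differentialAt n F p)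

/-- The normal plane `N_p M`. -/
def normalPlane (F : M → Euc k) (p : M) : Submodule ℝ (Euc k) :=
  (tangentPlane n F p)ᗮ

/-- The vector of the abstract tangent space which `dF` sends to `u` (unique for an immersion). -/
def tangentLift (F : M → Euc k) (p : M) (u : tangentPlane n F p) : TangentSpace (𝓡 n) p :=
  Function.surjInv (differentialAt n F p).surjective_rangeRestrict u

/-- The ambient (flat Levi-Civita) derivative of a vector field `Y : M → ℝ^k` along `M` in the
tangent direction `u`. -/
def ambientDeriv (F : M → Euc k) (Y : M → Euc k) (p : M) (u : tangentPlane n F p) : Euc k :=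
  differentialAt n Y p (tangentLift n F p u)

/-- The normal connection `∇_u ν`: the normal component of the ambient derivative of `ν`. -/
def normalConnection (F : M → Euc k) (ν : M → Euc k) (p : M) (u : tangentPlane n F p) : Euc k :=
  (normalPlane n F p).starProjection (ambientDeriv n F ν p u)

/-- The second fundamental form `B_{uv}`: the normal component at `p` of the ambient derivative in
direction `u` of a tangent vector field extending `v`. As `B` is tensorial the extension is
immaterial, and the tangential projection `q ↦ v^{T_q M}` of the constant field `v` is used. -/
def secondFundamentalForm (F : M → Euc k) (p : M) (u v : tangentPlane n F p) : Euc k :=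
  (normalPlane n F p).starProjection
    (ambientDeriv n F (fun q : M => (tangentPlane n F q).starProjection (v : Euc k)) p u)

/-- The mean curvature vector `H`: the trace `∑ᵢ B_{eᵢ eᵢ}` of the second fundamental form, for an
orthonormal basis `(eᵢ)` of `T_p M`. -/
def meanCurvature (F : M → Euc k) (p : M) : Euc k :=
  ∑ i, secondFundamentalForm n F p (stdOrthonormalBasis ℝ (tangentPlane n F p) i)
    (stdOrthonormalBasis ℝ (tangentPlane n F p) i)

/-- `M` is minimal: `H ≡ 0`. -/
def IsMinimalSubmanifold (F : M → Euc k) : Prop :=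
  ∀ p : M, meanCurvature n F p = 0

/-- `M` has parallel mean curvature: `∇ H ≡ 0` for the normal connection. -/
def HasParallelMeanCurvature (F : M → Euc k) : Prop :=
  ∀ (p : M) (u : tangentPlane n F p), normalConnection n F (meanCurvature n F) p u = 0

/-- `M` has constant Jordan angles (CJA) relative to `Q`: the set of Jordan angles between `N_p M`
and `Q`, and the multiplicity of each of them, do not depend on `p`. -/
def HasCJA (F : M → Euc k) (Q : Submodule ℝ (Euc k)) : Prop :=
  ∀ p q : M, jordanAngles (normalPlane n F p) Q = jordanAngles (normalPlane n F q) Q ∧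
    ∀ θ ∈ jordanAngles (normalPlane n F p) Q,
      jordanMultiplicity (normalPlane n F p) Q θ = jordanMultiplicity (normalPlane n F q) Q θ

/-- `Arg^N`: the constants that are a Jordan angle between `N_p M` and `Q` at every `p`. -/
def argN (F : M → Euc k) (Q : Submodule ℝ (Euc k)) : Set ℝ :=
  {θ | ∀ p : M, θ ∈ jordanAngles (normalPlane n F p) Q}

/-- `Arg^T`: the constants that are a Jordan angle between `T_p M` and `Q^⊥` at every `p`. -/
def argT (F : M → Euc k) (Q : Submodule ℝ (Euc k)) : Set ℝ :=
  {θ | ∀ p : M, θ ∈ jordanAngles (tangentPlane n F p) Qᗮ}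

/-- `g^N`, the number of distinct normal Jordan angles. -/
def numN (F : M → Euc k) (Q : Submodule ℝ (Euc k)) : ℕ := (argN n F Q).ncard

/-- `g^T`, the number of distinct tangent Jordan angles. -/
def numT (F : M → Euc k) (Q : Submodule ℝ (Euc k)) : ℕ := (argT n F Q).ncard

/-- `M` is affine linear: its image is a (relatively) open subset of an affine subspace whose
dimension is that of `M`. -/
def IsAffineLinear {M : Type*} (F : M → Euc k) : Prop :=
  ∃ W : AffineSubspace ℝ (Euc k), finrank ℝ W.direction = n ∧
    ∃ O : Set (Euc k), IsOpen O ∧ Set.range F = O ∩ (W : Set (Euc k))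

end Submanifold

end

/-!
Let `F : M → ℝ^(n+m)` have constant Jordan angles. The proof turns the four cases into statements
about maps between Euclidean spaces whose differential has constant singular values.

Fix an `n`-dimensional subspace `E` to which every tangent plane projects isomorphically. By the
inverse function theorem (`exists_isGraphChart`) `M` is locally the graph of a map `f : E → Eᗮ`.
Put `A = df` and `J v = v + A v`, so that `T_p M` is the range of `J`. The squared tangents of the
Jordan angles between `T_p M` and `E` are the eigenvalues of `A† A`, those of the angles between
`N_p M` and `Eᗮ` are the eigenvalues of `A A†`, and the spectral theorem
(`le_of_forall_angleSpace_le`) turns the hypotheses on the number of angles into polynomial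
identities for these operators. The second fundamental form is the normal part of the Hessian,
`B(J w, J z) = (D²f(w, z))^N`, and `H` is the normal part of the trace of `D²f` against
`(1 + A† A)⁻¹` (`meanCurvature_eq`). If all Hessians `D²f` vanish, then the tangent plane is locally
constant and `M` is affine (`isAffineLinear_of_fderiv_fderiv_eq_zero`).

The Hessian vanishes by Bochner's identity `½ Δ|df|² = |D²f|² + ⟨df, d Δf⟩`: the energy density
`|df|²` is constant, so it suffices that `⟨df, d Δf⟩ = 0`
(`fderiv_fderiv_eq_zero_of_bochner`). Differentiating the identity satisfied by `A` and using the
symmetry of `D²f` as in the proof of Koszul's formula gives what is needed in each case.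

* `A† A = μ`: then `D²f` is orthogonal to the range of `A`. If `A` is onto, `D²f = 0`. In general
  `(1 + μ) H = Δf`, and parallel mean curvature forces `d Δf = 0`.
* `A A† = μ`: then `D²f(A† a, A† b) = 0`, so `(1 + μ) H = Δf - A† Δf`, and parallel mean
  curvature expresses `d Δf` through `D²f` in such a way that `⟨df, d Δf⟩ = 0`.
* `A† A` has two eigenvalues: the traces of `D²f` over the two eigenspaces are each orthogonal to
  the image of their own eigenspace under `A`, while minimality makes them proportional. Hence both
  are orthogonal to the range of `A`. Both vanish if `A` is onto, and also if one eigenvalue is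
  zero, as then `A` has constant rank and `D²f` maps `ker A` into the range of `A`. So `f` is
  harmonic.

The subspace `E` is `Q₀ᗮ`, except for two tangential and two normal angles none of which is `0`.
Then `m = n` and `T_p M ∩ Q₀ᗮ = 0`, and `E = Q₀` works even when `π/2` is an angle. If there
is one tangential and one normal angle and the tangential one is `0` or `π/2`, the tangent plane
itself is constant. Finally, the tangential Jordan angles are the same at all points because
those other than `0` are shared with the normal plane, and `dim (T ∩ Q₀ᗮ)` is determined by
`dim (N ∩ Q₀)` (`HasCJA.jordanAngles_tangentPlane_eq`).
-/

open Filter Topology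

/-! ### Traces of bilinear maps -/

section Trace

variable {ι κ U V X : Type*} [Fintype ι] [Fintype κ]
  [NormedAddCommGroup U] [InnerProductSpace ℝ U] [CompleteSpace U]
  [NormedAddCommGroup V] [InnerProductSpace ℝ V] [CompleteSpace V]
  [NormedAddCommGroup X] [NormedSpace ℝ X]

/-- The trace of the pullback of a bilinear map `b` by `C` is the trace of `b` against `C C†`. -/
theorem sum_bilin_map_orthonormalBasis (b : V →L[ℝ] V →L[ℝ] X) (C : U →L[ℝ] V)
    (e : OrthonormalBasis ι ℝ U) (ε : OrthonormalBasis κ ℝ V) :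
    ∑ i, b (C (e i)) (C (e i)) = ∑ j, b (C (ContinuousLinearMap.adjoint C (ε j))) (ε j) := by
  have h1 : ∀ i, b (C (e i)) (C (e i)) = ∑ j, ⟪ε j, C (e i)⟫_ℝ • b (C (e i)) (ε j) := by
    intro i
    conv_lhs => rw [← ε.sum_repr' (C (e i)), map_sum]
    simp [ε.sum_repr']
  have h2 : ∀ j, b (C (ContinuousLinearMap.adjoint C (ε j))) (ε j) =
      ∑ i, ⟪ε j, C (e i)⟫_ℝ • b (C (e i)) (ε j) := by
    intro j
    conv_lhs => rw [← e.sum_repr' (ContinuousLinearMap.adjoint C (ε j))]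
    simp [ContinuousLinearMap.adjoint_inner_right, real_inner_comm (ε j)]
  simp_rw [h1, h2]
  exact Finset.sum_comm

/-- The trace of a bilinear map against a self-adjoint idempotent `R` is the trace of its
restriction to the range of `R`. -/
theorem sum_bilin_of_isIdempotent (b : V →L[ℝ] V →L[ℝ] X) (R : V →L[ℝ] V)
    (hR : ∀ v w, ⟪R v, w⟫_ℝ = ⟪v, R w⟫_ℝ) (hRR : ∀ v, R (R v) = R v)
    (ε : OrthonormalBasis κ ℝ V) :
    ∑ j, b (R (ε j)) (ε j) = ∑ j, b (R (ε j)) (R (ε j)) := by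
  have h : ContinuousLinearMap.adjoint R = R :=
    ((ContinuousLinearMap.eq_adjoint_iff R R).2 hR).symm
  rw [sum_bilin_map_orthonormalBasis b R ε ε, h]
  simp [hRR]

end Trace

/-! ### Derivatives of Hessians, and Bochner's argument -/

section Bochner

variable {ι E G : Type*} [Fintype ι]
  [NormedAddCommGroup E] [InnerProductSpace ℝ E]
  [NormedAddCommGroup G] [InnerProductSpace ℝ G]
  {E' G' : Type*} [NormedAddCommGroup E'] [NormedSpace ℝ E']
  [NormedAddCommGroup G'] [NormedSpace ℝ G']

theorem fderiv_apply_const {f : E' → E' →L[ℝ] G'} {x : E'} (hf : DifferentiableAt ℝ f x)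
    (u v : E') : fderiv ℝ (fun y => f y u) x v = fderiv ℝ f x v u := by
  rw [fderiv_clm_apply hf (differentiableAt_const u)]
  simp

theorem fderiv_apply_const₂ {f : E' → E' →L[ℝ] E' →L[ℝ] G'} {x : E'} (hf : DifferentiableAt ℝ f x)
    (u v w : E') : fderiv ℝ (fun y => f y u v) x w = fderiv ℝ f x w u v := by
  have h : DifferentiableAt ℝ (fun y => f y u) x := hf.clm_apply (differentiableAt_const u)
  rw [fderiv_apply_const h]
  rw [fderiv_clm_apply hf (differentiableAt_const u)]
  simp

theorem ContDiffAt.differentiableAt_fderiv {f : E' → G'} {x : E'} (hf : ContDiffAt ℝ 2 f x) :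
    DifferentiableAt ℝ (fderiv ℝ f) x :=
  (hf.fderiv_right (m := 1) (by norm_num)).differentiableAt one_ne_zero

theorem ContDiffAt.fderiv_fderiv_comm {f : E' → G'} {x : E'} (hf : ContDiffAt ℝ 2 f x) (u v : E') :
    fderiv ℝ (fderiv ℝ f) x u v = fderiv ℝ (fderiv ℝ f) x v u :=
  (hf.isSymmSndFDerivAt (by simp)).eq u v

theorem ContDiffAt.differentiableAt_fderiv_fderiv {f : E' → G'} {x : E'} (hf : ContDiffAt ℝ 3 f x) :
    DifferentiableAt ℝ (fderiv ℝ (fderiv ℝ f)) x :=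
  (hf.fderiv_right (m := 2) (by norm_num)).differentiableAt_fderiv

theorem ContDiffAt.fderiv_fderiv_fderiv_comm {f : E' → G'} {x : E'} (hf : ContDiffAt ℝ 3 f x)
    (u v w : E') : fderiv ℝ (fderiv ℝ (fderiv ℝ f)) x u v w =
      fderiv ℝ (fderiv ℝ (fderiv ℝ f)) x w u v := by
  rw [(hf.fderiv_right (m := 2) (by norm_num)).fderiv_fderiv_comm w u]
  have h := hf.differentiableAt_fderiv_fderiv
  rw [← fderiv_apply_const₂ h, ← fderiv_apply_const₂ h]
  congr 1
  refine Filter.EventuallyEq.fderiv_eq ?_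
  filter_upwards [hf.eventually (by decide)] with y hy
  exact (hy.of_le (by norm_num)).fderiv_fderiv_comm v w

/-- The Euclidean Laplacian of `f`, computed in an orthonormal basis `ε`. -/
noncomputable def basisLaplacian (ε : OrthonormalBasis ι ℝ E) (f : E → G) (x : E) : G :=
  ∑ i, fderiv ℝ (fderiv ℝ f) x (ε i) (ε i)

theorem differentiableAt_basisLaplacian (ε : OrthonormalBasis ι ℝ E) {f : E → G} {x : E}
    (hf : ContDiffAt ℝ 3 f x) : DifferentiableAt ℝ (basisLaplacian ε f) x := by
  have h := hf.differentiableAt_fderiv_fderiv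
  unfold basisLaplacian
  exact DifferentiableAt.fun_sum fun i _ =>
    (h.clm_apply (differentiableAt_const _)).clm_apply (differentiableAt_const _)

/-- Bochner's argument: if the energy density `|df|²` has vanishing differential near `x` and
`⟨df, d Δf⟩ = 0` at `x`, then the Hessian of `f` vanishes at `x`. -/
theorem fderiv_fderiv_eq_zero_of_bochner (ε : OrthonormalBasis ι ℝ E) {f : E → G} {x : E}
    (hf : ContDiffAt ℝ 3 f x)
    (h1 : ∀ᶠ y in 𝓝 x, ∀ w, ∑ j, ⟪fderiv ℝ (fderiv ℝ f) y w (ε j), fderiv ℝ f y (ε j)⟫_ℝ = 0)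
    (h2 : ∑ j, ⟪fderiv ℝ (basisLaplacian ε f) x (ε j), fderiv ℝ f x (ε j)⟫_ℝ = 0) :
    fderiv ℝ (fderiv ℝ f) x = 0 := by
  have d2 := hf.differentiableAt_fderiv_fderiv
  have d1 := (hf.of_le (by norm_num : (2 : ℕ∞ω) ≤ 3)).differentiableAt_fderiv
  have dd : ∀ u v, DifferentiableAt ℝ (fun y => fderiv ℝ (fderiv ℝ f) y u v) x := fun u v =>
    (d2.clm_apply (differentiableAt_const _)).clm_apply (differentiableAt_const _)
  have d1' : ∀ u, DifferentiableAt ℝ (fun y => fderiv ℝ f y u) x := fun u =>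
    d1.clm_apply (differentiableAt_const _)
  have hL : ∀ w, fderiv ℝ (basisLaplacian ε f) x w =
      ∑ i, fderiv ℝ (fderiv ℝ (fderiv ℝ f)) x w (ε i) (ε i) := by
    intro w
    unfold basisLaplacian
    rw [fderiv_fun_sum fun i _ => dd _ _]
    simp [fderiv_apply_const₂ d2]
  have key : ∀ i, ∑ j, (⟪fderiv ℝ (fderiv ℝ f) x (ε i) (ε j),
      fderiv ℝ (fderiv ℝ f) x (ε i) (ε j)⟫_ℝ +
      ⟪fderiv ℝ (fderiv ℝ (fderiv ℝ f)) x (ε j) (ε i) (ε i), fderiv ℝ f x (ε j)⟫_ℝ) = 0 := by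
    intro i
    have e1 : (fun y => ∑ j, ⟪fderiv ℝ (fderiv ℝ f) y (ε i) (ε j), fderiv ℝ f y (ε j)⟫_ℝ)
        =ᶠ[𝓝 x] fun _ => 0 := h1.mono fun y hy => hy (ε i)
    have e2 := congrArg (fun L : E →L[ℝ] ℝ => L (ε i)) e1.fderiv_eq
    rw [fderiv_fun_sum fun j _ => (dd _ _).inner ℝ (d1' _)] at e2
    simp only [sum_apply, fderiv_fun_const, Pi.zero_apply, zero_apply] at e2
    rw [← e2]
    refine Finset.sum_congr rfl fun j _ => ?_
    rw [fderiv_inner_apply ℝ (dd _ _) (d1' _), fderiv_apply_const₂ d2, fderiv_apply_const d1,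
      hf.fderiv_fderiv_fderiv_comm (ε i) (ε i) (ε j)]
  have tot : ∑ i, ∑ j, ⟪fderiv ℝ (fderiv ℝ f) x (ε i) (ε j),
      fderiv ℝ (fderiv ℝ f) x (ε i) (ε j)⟫_ℝ = 0 := by
    have := Finset.sum_eq_zero (s := Finset.univ) fun i _ => key i
    simp_rw [Finset.sum_add_distrib] at this
    rw [Finset.sum_comm (f := fun i j => ⟪fderiv ℝ (fderiv ℝ (fderiv ℝ f)) x (ε j) (ε i) (ε i),
      fderiv ℝ f x (ε j)⟫_ℝ)] at this
    simp_rw [← sum_inner, ← hL] at this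
    rw [h2, add_zero] at this
    exact this
  have hz : ∀ i j, fderiv ℝ (fderiv ℝ f) x (ε i) (ε j) = 0 := by
    intro i j
    have h := (Finset.sum_eq_zero_iff_of_nonneg fun i _ =>
      Finset.sum_nonneg fun j _ => real_inner_self_nonneg).1 tot i (Finset.mem_univ i)
    have h' := (Finset.sum_eq_zero_iff_of_nonneg fun j _ => real_inner_self_nonneg).1 h j
      (Finset.mem_univ j)
    exact inner_self_eq_zero.1 h'
  ext u v
  rw [← ε.sum_repr' u, ← ε.sum_repr' v]
  simp [hz]

end Bochner

/-! ### Rigidity of maps whose differential has constant singular values -/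

section Rigidity

variable {ι κ E G : Type*} [Fintype ι] [Fintype κ]
  [NormedAddCommGroup E] [InnerProductSpace ℝ E]
  [NormedAddCommGroup G] [InnerProductSpace ℝ G]

/-- A trilinear form symmetric in its first two arguments and skew in its last two vanishes, as in
the derivation of Koszul's formula. -/
theorem eq_zero_of_symm_of_skew {V : Type*} (τ : V → V → V → ℝ) (h1 : ∀ u v w, τ u v w = τ v u w)
    (h2 : ∀ u v w, τ u v w = -τ u w v) (u v w : V) : τ u v w = 0 := by
  linarith [h2 u v w, h1 u w v, h2 w u v, h1 w v u, h2 v w u, h1 v u w]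

variable {f : E → G} {x : E} {μ : ℝ}

/-- The Hessian of a local similarity is orthogonal to the range of its differential. -/
theorem inner_fderiv_fderiv_of_isometric (hf : ContDiffAt ℝ 2 f x)
    (h : ∀ᶠ y in 𝓝 x, ∀ v w, ⟪fderiv ℝ f y v, fderiv ℝ f y w⟫_ℝ = μ * ⟪v, w⟫_ℝ) (u v w : E) :
    ⟪fderiv ℝ (fderiv ℝ f) x u v, fderiv ℝ f x w⟫_ℝ = 0 := by
  have d1 := hf.differentiableAt_fderiv
  have d1' : ∀ u, DifferentiableAt ℝ (fun y => fderiv ℝ f y u) x := fun u =>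
    d1.clm_apply (differentiableAt_const _)
  refine eq_zero_of_symm_of_skew
    (fun u v w => ⟪fderiv ℝ (fderiv ℝ f) x u v, fderiv ℝ f x w⟫_ℝ) ?_ ?_ u v w
  · intro u v w
    simp only [hf.fderiv_fderiv_comm u v]
  · intro u v w
    have e1 : (fun y => ⟪fderiv ℝ f y v, fderiv ℝ f y w⟫_ℝ) =ᶠ[𝓝 x] fun _ => μ * ⟪v, w⟫_ℝ :=
      h.mono fun y hy => hy v w
    have e2 := congrArg (fun L : E →L[ℝ] ℝ => L u) e1.fderiv_eq
    simp only [fderiv_fun_const, Pi.zero_apply, zero_apply] at e2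
    rw [fderiv_inner_apply ℝ (d1' v) (d1' w), fderiv_apply_const d1, fderiv_apply_const d1] at e2
    rw [real_inner_comm] at e2
    linarith

theorem fderiv_fderiv_eq_zero_of_isometric_of_surjective (hf : ContDiffAt ℝ 2 f x)
    (h : ∀ᶠ y in 𝓝 x, ∀ v w, ⟪fderiv ℝ f y v, fderiv ℝ f y w⟫_ℝ = μ * ⟪v, w⟫_ℝ)
    (hs : Function.Surjective (fderiv ℝ f x)) : fderiv ℝ (fderiv ℝ f) x = 0 := by
  ext u v
  obtain ⟨w, hw⟩ := hs (fderiv ℝ (fderiv ℝ f) x u v)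
  have := inner_fderiv_fderiv_of_isometric hf h u v w
  rw [hw] at this
  simpa using this

theorem fderiv_fderiv_eq_zero_of_isometric (ε : OrthonormalBasis ι ℝ E) (hf : ContDiffAt ℝ 3 f x)
    (h : ∀ᶠ y in 𝓝 x, ∀ v w, ⟪fderiv ℝ f y v, fderiv ℝ f y w⟫_ℝ = μ * ⟪v, w⟫_ℝ)
    (hL : fderiv ℝ (basisLaplacian ε f) x = 0) : fderiv ℝ (fderiv ℝ f) x = 0 := by
  refine fderiv_fderiv_eq_zero_of_bochner ε hf ?_ (by simp [hL])
  filter_upwards [hf.eventually (by decide), h.eventually_nhds] with y hy h' w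
  exact Finset.sum_eq_zero fun j _ =>
    inner_fderiv_fderiv_of_isometric (hy.of_le (by norm_num)) h' w (ε j) (ε j)

variable [CompleteSpace E] [CompleteSpace G]

/-- The real adjoint, as a continuous linear map. -/
noncomputable def realAdjoint (E G : Type*)
    [NormedAddCommGroup E] [InnerProductSpace ℝ E] [CompleteSpace E]
    [NormedAddCommGroup G] [InnerProductSpace ℝ G] [CompleteSpace G] :
    (E →L[ℝ] G) →L[ℝ] (G →L[ℝ] E) :=
  LinearMap.mkContinuous
    { toFun := ContinuousLinearMap.adjoint
      map_add' := map_add _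
      map_smul' := fun c A => by simp } 1 fun A => by simp

@[simp] theorem realAdjoint_apply (A : E →L[ℝ] G) :
    realAdjoint E G A = ContinuousLinearMap.adjoint A := rfl

theorem differentiableAt_realAdjoint {X : Type*} [NormedAddCommGroup X] [NormedSpace ℝ X]
    {A : X → E →L[ℝ] G} {z : X} (hA : DifferentiableAt ℝ A z) :
    DifferentiableAt ℝ (fun y => realAdjoint E G (A y)) z :=
  (realAdjoint E G).differentiableAt.comp z hA

/-- `tr (A† B) = tr (B A†)`. -/
theorem sum_inner_comp_eq_sum_inner_adjoint (A B : E →L[ℝ] G) (ε : OrthonormalBasis ι ℝ E)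
    (η : OrthonormalBasis κ ℝ G) :
    ∑ j, ⟪B (ε j), A (ε j)⟫_ℝ = ∑ a, ⟪B (ContinuousLinearMap.adjoint A (η a)), η a⟫_ℝ := by
  have h1 : ∀ j, ⟪B (ε j), A (ε j)⟫_ℝ = ∑ a, ⟪A (ε j), η a⟫_ℝ * ⟪B (ε j), η a⟫_ℝ := by
    intro j
    rw [← η.sum_inner_mul_inner (B (ε j))]
    exact Finset.sum_congr rfl fun a _ => by rw [real_inner_comm (η a) (A (ε j)), mul_comm]
  have h2 : ∀ a, ⟪B (ContinuousLinearMap.adjoint A (η a)), η a⟫_ℝ =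
      ∑ j, ⟪A (ε j), η a⟫_ℝ * ⟪B (ε j), η a⟫_ℝ := by
    intro a
    conv_lhs => rw [← ε.sum_repr' (ContinuousLinearMap.adjoint A (η a))]
    simp [ContinuousLinearMap.adjoint_inner_right, sum_inner, inner_smul_left]
  simp_rw [h1, h2]
  exact Finset.sum_comm

theorem hasFDerivAt_adjoint_basisLaplacian (ε : OrthonormalBasis ι ℝ E) (hf : ContDiffAt ℝ 3 f x) :
    HasFDerivAt (fun y => ContinuousLinearMap.adjoint (fderiv ℝ f y) (basisLaplacian ε f y))
      (ContinuousLinearMap.adjoint (fderiv ℝ f x) ∘L fderiv ℝ (basisLaplacian ε f) x +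
        (realAdjoint E G ∘L fderiv ℝ (fderiv ℝ f) x).flip (basisLaplacian ε f x)) x := by
  have d1 : HasFDerivAt (fderiv ℝ f) _ x :=
    (hf.of_le (by norm_num : (2 : ℕ∞ω) ≤ 3)).differentiableAt_fderiv.hasFDerivAt
  exact ((realAdjoint E G).hasFDerivAt.comp x d1).clm_apply
    (differentiableAt_basisLaplacian ε hf).hasFDerivAt

theorem inner_fderiv_fderiv_adjoint_skew (hf : ContDiffAt ℝ 2 f x)
    (h : ∀ᶠ y in 𝓝 x, ∀ a b, ⟪ContinuousLinearMap.adjoint (fderiv ℝ f y) a,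
      ContinuousLinearMap.adjoint (fderiv ℝ f y) b⟫_ℝ = μ * ⟪a, b⟫_ℝ) (u : E) (a b : G) :
    ⟪fderiv ℝ (fderiv ℝ f) x u (ContinuousLinearMap.adjoint (fderiv ℝ f x) a), b⟫_ℝ =
      -⟪fderiv ℝ (fderiv ℝ f) x u (ContinuousLinearMap.adjoint (fderiv ℝ f x) b), a⟫_ℝ := by
  have d1 : HasFDerivAt (fderiv ℝ f) _ x := hf.differentiableAt_fderiv.hasFDerivAt
  have dA : ∀ a, HasFDerivAt (fun y => ContinuousLinearMap.adjoint (fderiv ℝ f y) a) _ x :=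
    fun a => ((realAdjoint E G).hasFDerivAt.comp x d1).clm_apply (hasFDerivAt_const a x)
  have e1 : (fun y => ⟪ContinuousLinearMap.adjoint (fderiv ℝ f y) a,
      ContinuousLinearMap.adjoint (fderiv ℝ f y) b⟫_ℝ) =ᶠ[𝓝 x] fun _ => μ * ⟪a, b⟫_ℝ :=
    h.mono fun y hy => hy a b
  have e2 := congrArg (fun L : E →L[ℝ] ℝ => L u) e1.fderiv_eq
  simp only [fderiv_fun_const, Pi.zero_apply, zero_apply] at e2
  rw [fderiv_inner_apply ℝ (dA a).differentiableAt (dA b).differentiableAt, (dA a).fderiv,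
    (dA b).fderiv] at e2
  simp only [realAdjoint_apply, ContinuousLinearMap.comp_zero, zero_add,
    ContinuousLinearMap.flip_apply, ContinuousLinearMap.comp_apply] at e2
  rw [ContinuousLinearMap.adjoint_inner_right, ContinuousLinearMap.adjoint_inner_left,
    real_inner_comm _ a] at e2
  linarith

theorem fderiv_fderiv_adjoint_adjoint_eq_zero (hf : ContDiffAt ℝ 2 f x)
    (h : ∀ᶠ y in 𝓝 x, ∀ a b, ⟪ContinuousLinearMap.adjoint (fderiv ℝ f y) a,
      ContinuousLinearMap.adjoint (fderiv ℝ f y) b⟫_ℝ = μ * ⟪a, b⟫_ℝ) (a b : G) :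
    fderiv ℝ (fderiv ℝ f) x (ContinuousLinearMap.adjoint (fderiv ℝ f x) a)
      (ContinuousLinearMap.adjoint (fderiv ℝ f x) b) = 0 := by
  rw [← inner_self_eq_zero (𝕜 := ℝ)]
  refine eq_zero_of_symm_of_skew (fun a b c => ⟪fderiv ℝ (fderiv ℝ f) x
    (ContinuousLinearMap.adjoint (fderiv ℝ f x) a)
    (ContinuousLinearMap.adjoint (fderiv ℝ f x) b), c⟫_ℝ) ?_ ?_ a b _
  · intro a b c
    simp only [hf.fderiv_fderiv_comm (ContinuousLinearMap.adjoint (fderiv ℝ f x) a)]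
  · intro a b c
    exact inner_fderiv_fderiv_adjoint_skew hf h _ b c

/-- The hypothesis `hL` is the parallel mean curvature equation for the graph of `f`. It enters
Bochner's argument through the trace of `d Δf ∘ A†`, to which `Δf` contributes only through
`D²f(A† a, A† a) = 0`. -/
theorem fderiv_fderiv_eq_zero_of_coisometric (ε : OrthonormalBasis ι ℝ E)
    (η : OrthonormalBasis κ ℝ G) (hμ : 0 ≤ μ) (hf : ContDiffAt ℝ 3 f x)
    (h : ∀ᶠ y in 𝓝 x, ∀ a b, ⟪ContinuousLinearMap.adjoint (fderiv ℝ f y) a,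
      ContinuousLinearMap.adjoint (fderiv ℝ f y) b⟫_ℝ = μ * ⟪a, b⟫_ℝ)
    (hL : ∀ w b, (1 + μ) * ⟪fderiv ℝ (basisLaplacian ε f) x w, b⟫_ℝ + ⟪basisLaplacian ε f x,
      fderiv ℝ (fderiv ℝ f) x w (ContinuousLinearMap.adjoint (fderiv ℝ f x) b)⟫_ℝ = 0) :
    fderiv ℝ (fderiv ℝ f) x = 0 := by
  refine fderiv_fderiv_eq_zero_of_bochner ε hf ?_ ?_
  · filter_upwards [hf.eventually (by decide), h.eventually_nhds] with y hy h' w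
    rw [sum_inner_comp_eq_sum_inner_adjoint _ _ ε η]
    refine Finset.sum_eq_zero fun a _ => ?_
    linarith [inner_fderiv_fderiv_adjoint_skew (hy.of_le (by norm_num)) h' w (η a) (η a)]
  · rw [sum_inner_comp_eq_sum_inner_adjoint _ _ ε η]
    refine Finset.sum_eq_zero fun a _ => ?_
    have h1 := hL (ContinuousLinearMap.adjoint (fderiv ℝ f x) (η a)) (η a)
    rw [fderiv_fderiv_adjoint_adjoint_eq_zero (hf.of_le (by norm_num)) h, inner_zero_right,
      add_zero] at h1
    exact (mul_eq_zero.1 h1).resolve_left (by positivity)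

end Rigidity

/-! ### Two constant singular values -/

section TwoSingularValues

variable {ι E G : Type*} [Fintype ι]
  [NormedAddCommGroup E] [InnerProductSpace ℝ E] [CompleteSpace E]
  [NormedAddCommGroup G] [InnerProductSpace ℝ G] [CompleteSpace G]

/-- The operator `A† A`, whose eigenvalues are the squares of the singular values of `A`. -/
noncomputable def gramOp (A : E →L[ℝ] G) : E →L[ℝ] E := ContinuousLinearMap.adjoint A ∘L A

theorem inner_gramOp_left (A : E →L[ℝ] G) (v w : E) : ⟪gramOp A v, w⟫_ℝ = ⟪A v, A w⟫_ℝ := by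
  simp [gramOp, ContinuousLinearMap.adjoint_inner_left]

theorem inner_gramOp_right (A : E →L[ℝ] G) (v w : E) : ⟪v, gramOp A w⟫_ℝ = ⟪A v, A w⟫_ℝ := by
  simp [gramOp, ContinuousLinearMap.adjoint_inner_right]

/-- The identity `(A† A - μ₁) (A† A - μ₂) = 0`: the squared singular values of `A` are among `μ₁`
and `μ₂`. -/
def HasGramValues (A : E →L[ℝ] G) (μ₁ μ₂ : ℝ) : Prop :=
  ∀ v, gramOp A (gramOp A v) = (μ₁ + μ₂) • gramOp A v - (μ₁ * μ₂) • v

/-- The spectral projection of `A† A` onto the `μ₂`-eigenspace, if the eigenvalues are `μ₁ ≠ μ₂`. -/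
noncomputable def gramProj (A : E →L[ℝ] G) (μ₁ μ₂ : ℝ) : E →L[ℝ] E :=
  (μ₂ - μ₁)⁻¹ • (gramOp A - μ₁ • ContinuousLinearMap.id ℝ E)

variable {f : E → G} {x : E} {μ₁ μ₂ : ℝ}

theorem HasGramValues.symm {A : E →L[ℝ] G} (h : HasGramValues A μ₁ μ₂) : HasGramValues A μ₂ μ₁ := by
  intro v
  rw [h v, add_comm, mul_comm]

theorem gramProj_add_gramProj (A : E →L[ℝ] G) (hne : μ₁ ≠ μ₂) (v : E) :
    gramProj A μ₁ μ₂ v + gramProj A μ₂ μ₁ v = v := by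
  have h1 : μ₂ - μ₁ ≠ 0 := sub_ne_zero.2 hne.symm
  have h2 : (μ₁ - μ₂)⁻¹ = -(μ₂ - μ₁)⁻¹ := by rw [← inv_neg, neg_sub]
  simp only [gramProj, h2, smul_apply, sub_apply, ContinuousLinearMap.id_apply]
  rw [neg_smul, ← sub_eq_add_neg, ← smul_sub, sub_sub_sub_cancel_left, ← sub_smul, smul_smul,
    inv_mul_cancel₀ h1, one_smul]

theorem inner_gramProj (A : E →L[ℝ] G) (v w : E) :
    ⟪gramProj A μ₁ μ₂ v, w⟫_ℝ = ⟪v, gramProj A μ₁ μ₂ w⟫_ℝ := by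
  simp [gramProj, inner_smul_left, inner_smul_right, inner_sub_left, inner_sub_right,
    inner_gramOp_left, inner_gramOp_right]

theorem HasGramValues.gramOp_gramProj {A : E →L[ℝ] G} (h : HasGramValues A μ₁ μ₂) (v : E) :
    gramOp A (gramProj A μ₁ μ₂ v) = μ₂ • gramProj A μ₁ μ₂ v := by
  simp only [gramProj, smul_apply, sub_apply, ContinuousLinearMap.id_apply, map_smul, map_sub, h v]
  module

theorem HasGramValues.gramProj_gramProj {A : E →L[ℝ] G} (h : HasGramValues A μ₁ μ₂) (hne : μ₁ ≠ μ₂)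
    (v : E) : gramProj A μ₁ μ₂ (gramProj A μ₁ μ₂ v) = gramProj A μ₁ μ₂ v := by
  have h1 : μ₂ - μ₁ ≠ 0 := sub_ne_zero.2 hne.symm
  change (μ₂ - μ₁)⁻¹ • (gramOp A (gramProj A μ₁ μ₂ v) - μ₁ • gramProj A μ₁ μ₂ v) = _
  rw [h.gramOp_gramProj, ← sub_smul, smul_smul, inv_mul_cancel₀ h1, one_smul]

theorem differentiableAt_inverse_one_add_gramOp {X : Type*} [NormedAddCommGroup X]
    [NormedSpace ℝ X] {A : X → E →L[ℝ] G} {z : X} (hA : DifferentiableAt ℝ A z)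
    (hu : IsUnit (1 + gramOp (A z))) :
    DifferentiableAt ℝ (fun y => Ring.inverse (1 + gramOp (A y))) z :=
  DifferentiableAt.inverse (R := E →L[ℝ] E)
    (((differentiableAt_realAdjoint hA).clm_comp hA).const_add (1 : E →L[ℝ] E)) hu

theorem hasFDerivAt_gramOp_apply (hf : ContDiffAt ℝ 2 f x) (v : E) :
    HasFDerivAt (fun y => gramOp (fderiv ℝ f y) v)
      ((ContinuousLinearMap.adjoint (fderiv ℝ f x)) ∘L (fderiv ℝ (fderiv ℝ f) x).flip v +
        ((realAdjoint E G) ∘L (fderiv ℝ (fderiv ℝ f) x)).flip (fderiv ℝ f x v)) x := by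
  have d1 : HasFDerivAt (fderiv ℝ f) _ x := hf.differentiableAt_fderiv.hasFDerivAt
  have d2 := d1.clm_apply (hasFDerivAt_const v x)
  rw [ContinuousLinearMap.comp_zero, zero_add] at d2
  exact ((realAdjoint E G).hasFDerivAt.comp x d1).clm_apply d2

/-- The derivative of `A† A` restricts to zero on each eigenspace. -/
theorem gramOp_skew (hf : ContDiffAt ℝ 2 f x) (hne : μ₁ ≠ μ₂)
    (h : ∀ᶠ y in 𝓝 x, HasGramValues (fderiv ℝ f y) μ₁ μ₂) (u v w : E)
    (hv : gramOp (fderiv ℝ f x) v = μ₂ • v) (hw : gramOp (fderiv ℝ f x) w = μ₂ • w) :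
    ⟪fderiv ℝ (fderiv ℝ f) x u v, fderiv ℝ f x w⟫_ℝ =
      -⟪fderiv ℝ (fderiv ℝ f) x u w, fderiv ℝ f x v⟫_ℝ := by
  have d1 : HasFDerivAt (fderiv ℝ f) _ x := hf.differentiableAt_fderiv.hasFDerivAt
  have dA : ∀ v, HasFDerivAt (fun y => fderiv ℝ f y v) _ x := fun v =>
    d1.clm_apply (hasFDerivAt_const v x)
  have dD := hasFDerivAt_gramOp_apply hf
  -- `⟨D v, D w⟩ = (μ₁ + μ₂) ⟨A v, A w⟩ - μ₁ μ₂ ⟨v, w⟩`, to be differentiated in direction `u`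
  have e1 : (fun y => ⟪gramOp (fderiv ℝ f y) v, gramOp (fderiv ℝ f y) w⟫_ℝ) =ᶠ[𝓝 x]
      fun y => (μ₁ + μ₂) * ⟪fderiv ℝ f y v, fderiv ℝ f y w⟫_ℝ - μ₁ * μ₂ * ⟪v, w⟫_ℝ := by
    filter_upwards [h] with y hy
    rw [inner_gramOp_left, ← inner_gramOp_right, hy w, inner_sub_right, inner_smul_right,
      inner_smul_right, inner_gramOp_right]
  have e2 := congrArg (fun L : E →L[ℝ] ℝ => L u) e1.fderiv_eq
  have hd := (dA v).differentiableAt.inner ℝ (dA w).differentiableAt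
  rw [fderiv_sub_const, fderiv_const_mul hd, smul_apply,
    fderiv_inner_apply ℝ (dA v).differentiableAt (dA w).differentiableAt,
    fderiv_inner_apply ℝ (dD v).differentiableAt (dD w).differentiableAt, (dD v).fderiv,
    (dD w).fderiv, fderiv_apply_const hf.differentiableAt_fderiv,
    fderiv_apply_const hf.differentiableAt_fderiv] at e2
  simp only [hv, hw, add_apply, ContinuousLinearMap.comp_apply, ContinuousLinearMap.flip_apply,
    realAdjoint_apply, inner_add_left, inner_add_right, inner_smul_left, inner_smul_right,
    map_smul, ContinuousLinearMap.adjoint_inner_left, ContinuousLinearMap.adjoint_inner_right,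
    smul_eq_mul, conj_trivial] at e2
  have c1 := real_inner_comm (fderiv ℝ f x v) (fderiv ℝ (fderiv ℝ f) x u w)
  have c2 := real_inner_comm (fderiv ℝ f x w) (fderiv ℝ (fderiv ℝ f) x u v)
  have h3 : (μ₂ - μ₁) * (⟪fderiv ℝ (fderiv ℝ f) x u v, fderiv ℝ f x w⟫_ℝ +
      ⟪fderiv ℝ (fderiv ℝ f) x u w, fderiv ℝ f x v⟫_ℝ) = 0 := by
    simp only [c1, c2] at e2 ⊢
    linarith
  have := (mul_eq_zero.1 h3).resolve_left (sub_ne_zero.2 hne.symm)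
  linarith

theorem inner_fderiv_fderiv_gramProj (hf : ContDiffAt ℝ 2 f x) (hne : μ₁ ≠ μ₂)
    (h : ∀ᶠ y in 𝓝 x, HasGramValues (fderiv ℝ f y) μ₁ μ₂) (u v w : E) :
    ⟪fderiv ℝ (fderiv ℝ f) x (gramProj (fderiv ℝ f x) μ₁ μ₂ u) (gramProj (fderiv ℝ f x) μ₁ μ₂ v),
      fderiv ℝ f x (gramProj (fderiv ℝ f x) μ₁ μ₂ w)⟫_ℝ = 0 := by
  have hx := h.self_of_nhds
  refine eq_zero_of_symm_of_skew (fun u v w => ⟪fderiv ℝ (fderiv ℝ f) x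
    (gramProj (fderiv ℝ f x) μ₁ μ₂ u) (gramProj (fderiv ℝ f x) μ₁ μ₂ v),
      fderiv ℝ f x (gramProj (fderiv ℝ f x) μ₁ μ₂ w)⟫_ℝ) ?_ ?_ u v w
  · intro u v w
    simp only [hf.fderiv_fderiv_comm (gramProj (fderiv ℝ f x) μ₁ μ₂ u)]
  · intro u v w
    exact gramOp_skew hf hne h _ _ _ (hx.gramOp_gramProj v) (hx.gramOp_gramProj w)

/-- The trace of the Hessian over the `μ₂`-eigenspace of `A† A`. -/
noncomputable def partialLaplacian (ε : OrthonormalBasis ι ℝ E) (f : E → G) (x : E) (μ₁ μ₂ : ℝ) :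
    G := ∑ j, fderiv ℝ (fderiv ℝ f) x (gramProj (fderiv ℝ f x) μ₁ μ₂ (ε j)) (ε j)

theorem HasGramValues.partialLaplacian_eq (ε : OrthonormalBasis ι ℝ E) (hne : μ₁ ≠ μ₂)
    (h : HasGramValues (fderiv ℝ f x) μ₁ μ₂) : partialLaplacian ε f x μ₁ μ₂ =
      ∑ j, fderiv ℝ (fderiv ℝ f) x (gramProj (fderiv ℝ f x) μ₁ μ₂ (ε j))
        (gramProj (fderiv ℝ f x) μ₁ μ₂ (ε j)) :=
  sum_bilin_of_isIdempotent _ _ (inner_gramProj _) (h.gramProj_gramProj hne) ε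

theorem basisLaplacian_eq_partialLaplacian_add (ε : OrthonormalBasis ι ℝ E) (hne : μ₁ ≠ μ₂) :
    basisLaplacian ε f x = partialLaplacian ε f x μ₁ μ₂ + partialLaplacian ε f x μ₂ μ₁ := by
  simp only [basisLaplacian, partialLaplacian, ← Finset.sum_add_distrib, ← add_apply, ← map_add,
    gramProj_add_gramProj _ hne]

theorem inner_partialLaplacian_gramProj (ε : OrthonormalBasis ι ℝ E) (hf : ContDiffAt ℝ 2 f x)
    (hne : μ₁ ≠ μ₂) (h : ∀ᶠ y in 𝓝 x, HasGramValues (fderiv ℝ f y) μ₁ μ₂) (w : E) :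
    ⟪partialLaplacian ε f x μ₁ μ₂, fderiv ℝ f x (gramProj (fderiv ℝ f x) μ₁ μ₂ w)⟫_ℝ = 0 := by
  rw [h.self_of_nhds.partialLaplacian_eq ε hne, sum_inner]
  exact Finset.sum_eq_zero fun j _ => inner_fderiv_fderiv_gramProj hf hne h _ _ _

/-- If `0` is one of the two eigenvalues, `A` has constant rank, and so the Hessian maps the kernel
of `A` into the range of `A`. -/
theorem partialLaplacian_mem_range (ε : OrthonormalBasis ι ℝ E) (hf : ContDiffAt ℝ 2 f x)
    (hμ : μ₂ ≠ 0) (h : ∀ᶠ y in 𝓝 x, HasGramValues (fderiv ℝ f y) μ₂ 0) :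
    partialLaplacian ε f x μ₂ 0 ∈ LinearMap.range (fderiv ℝ f x).toLinearMap := by
  have d1 : HasFDerivAt (fderiv ℝ f) _ x := hf.differentiableAt_fderiv.hasFDerivAt
  have dA : ∀ v, HasFDerivAt (fun y => fderiv ℝ f y v) _ x := fun v =>
    d1.clm_apply (hasFDerivAt_const v x)
  rw [h.self_of_nhds.partialLaplacian_eq ε hμ]
  refine Submodule.sum_mem _ fun j _ => ?_
  set v := gramProj (fderiv ℝ f x) μ₂ 0 (ε j) with hv
  have hv0 : gramOp (fderiv ℝ f x) v = 0 := by rw [h.self_of_nhds.gramOp_gramProj]; simp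
  have e1 : (fun y => fderiv ℝ f y (gramOp (fderiv ℝ f y) v)) =ᶠ[𝓝 x]
      fun y => μ₂ • fderiv ℝ f y v := by
    filter_upwards [h] with y hy
    rw [← sub_eq_zero, ← map_smul, ← map_sub, ← inner_self_eq_zero (𝕜 := ℝ), ← inner_gramOp_left,
      map_sub, hy v, map_smul]
    simp
  have e2 := congrArg (fun L : E →L[ℝ] G => L v) e1.fderiv_eq
  rw [(d1.clm_apply (hasFDerivAt_gramOp_apply hf v)).fderiv, ((dA v).fun_const_smul μ₂).fderiv,
    hv0] at e2
  simp only [map_zero, add_zero, smul_apply, add_apply, ContinuousLinearMap.comp_apply,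
    ContinuousLinearMap.flip_apply, ContinuousLinearMap.comp_zero, zero_add] at e2
  refine ⟨μ₂⁻¹ • (ContinuousLinearMap.adjoint (fderiv ℝ f x) (fderiv ℝ (fderiv ℝ f) x v v) +
    ContinuousLinearMap.adjoint (fderiv ℝ (fderiv ℝ f) x v) (fderiv ℝ f x v)), ?_⟩
  change fderiv ℝ f x (μ₂⁻¹ • _) = _
  rw [map_smul]
  exact (inv_smul_eq_iff₀ hμ).2 e2

/-- The Hessian has no trace over either eigenspace: the two traces are orthogonal to the range of
`A`, and they either lie in it or the range is everything. -/
theorem partialLaplacian_eq_zero (ε : OrthonormalBasis ι ℝ E) (hf : ContDiffAt ℝ 2 f x)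
    (hne : μ₁ ≠ μ₂) (hμ₁ : 0 ≤ μ₁) (hμ₂ : 0 ≤ μ₂)
    (h : ∀ᶠ y in 𝓝 x, HasGramValues (fderiv ℝ f y) μ₁ μ₂)
    (hs : Function.Surjective (fderiv ℝ f x) ∨ μ₁ = 0)
    (hmin : (1 + μ₁)⁻¹ • partialLaplacian ε f x μ₂ μ₁ +
      (1 + μ₂)⁻¹ • partialLaplacian ε f x μ₁ μ₂ = 0) :
    partialLaplacian ε f x μ₁ μ₂ = 0 ∧ partialLaplacian ε f x μ₂ μ₁ = 0 := by
  set a := partialLaplacian ε f x μ₂ μ₁ with ha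
  set b := partialLaplacian ε f x μ₁ μ₂ with hb
  have p1 : (1 + μ₁)⁻¹ ≠ 0 := by positivity
  have p2 : (1 + μ₂)⁻¹ ≠ 0 := by positivity
  have hsymm : ∀ᶠ y in 𝓝 x, HasGramValues (fderiv ℝ f y) μ₂ μ₁ := h.mono fun y hy => hy.symm
  have a1 := inner_partialLaplacian_gramProj ε hf hne.symm hsymm
  have b2 := inner_partialLaplacian_gramProj ε hf hne h
  rw [← ha] at a1
  rw [← hb] at b2
  have a2 : ∀ w, ⟪a, fderiv ℝ f x (gramProj (fderiv ℝ f x) μ₁ μ₂ w)⟫_ℝ = 0 := by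
    intro w
    have := congrArg (fun z => ⟪z, fderiv ℝ f x (gramProj (fderiv ℝ f x) μ₁ μ₂ w)⟫_ℝ) hmin
    simp only [inner_add_left, inner_smul_left, b2, mul_zero, add_zero, inner_zero_left,
      conj_trivial] at this
    exact (mul_eq_zero.1 this).resolve_left p1
  have aw : ∀ w, ⟪a, fderiv ℝ f x w⟫_ℝ = 0 := by
    intro w
    rw [← gramProj_add_gramProj (fderiv ℝ f x) hne w, map_add, inner_add_right, a1, a2, add_zero]
  have ha0 : a = 0 := by
    have hmem : ∃ w, fderiv ℝ f x w = a := by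
      rcases hs with hs | rfl
      · exact hs a
      · exact partialLaplacian_mem_range ε hf hne.symm hsymm
    obtain ⟨w, hw⟩ := hmem
    have := aw w
    rw [hw] at this
    exact inner_self_eq_zero.1 this
  rw [ha0, smul_zero, zero_add] at hmin
  exact ⟨(smul_eq_zero.1 hmin).resolve_left p2, ha0⟩

/-- The derivative of `A† A` has vanishing trace over each eigenspace; in particular the energy
density is constant, without any hypothesis on multiplicities. -/
theorem sum_inner_gramProj_eq_zero (ε : OrthonormalBasis ι ℝ E) (hf : ContDiffAt ℝ 2 f x)
    (hne : μ₁ ≠ μ₂) (h : ∀ᶠ y in 𝓝 x, HasGramValues (fderiv ℝ f y) μ₁ μ₂) (u : E) :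
    ∑ j, (⟪fderiv ℝ (fderiv ℝ f) x u (gramProj (fderiv ℝ f x) μ₁ μ₂ (ε j)), fderiv ℝ f x (ε j)⟫_ℝ +
      ⟪fderiv ℝ (fderiv ℝ f) x u (ε j), fderiv ℝ f x (gramProj (fderiv ℝ f x) μ₁ μ₂ (ε j))⟫_ℝ) =
      0 := by
  have hx := h.self_of_nhds
  set A := fderiv ℝ f x with hA
  set B := fderiv ℝ (fderiv ℝ f) x u with hB
  -- the derivative of `(v, w) ↦ ⟨A v, A w⟩` in direction `u`
  let β : E →L[ℝ] E →L[ℝ] ℝ := (innerSL ℝ : E →L[ℝ] E →L[ℝ] ℝ) ∘L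
    (ContinuousLinearMap.adjoint A ∘L B + ContinuousLinearMap.adjoint B ∘L A)
  have hβ : ∀ v w, β v w = ⟪B v, A w⟫_ℝ + ⟪B w, A v⟫_ℝ := by
    intro v w
    change ⟪ContinuousLinearMap.adjoint A (B v) + ContinuousLinearMap.adjoint B (A v), w⟫_ℝ = _
    rw [inner_add_left, ContinuousLinearMap.adjoint_inner_left,
      ContinuousLinearMap.adjoint_inner_left, real_inner_comm (A v)]
  have := sum_bilin_of_isIdempotent β (gramProj A μ₁ μ₂) (inner_gramProj A)
    (hx.gramProj_gramProj hne) ε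
  simp only [hβ] at this
  rw [this]
  refine Finset.sum_eq_zero fun j _ => ?_
  have := gramOp_skew hf hne h u _ _ (hx.gramOp_gramProj (ε j)) (hx.gramOp_gramProj (ε j))
  linarith

/-- A map whose differential has two constant singular values and whose graph is minimal is affine,
provided that the differential is onto or has a kernel: the Hessian is trace free over both
eigenspaces, so the map is harmonic with constant energy density. -/
theorem fderiv_fderiv_eq_zero_of_hasGramValues (ε : OrthonormalBasis ι ℝ E)
    (hne : μ₁ ≠ μ₂) (hμ₁ : 0 ≤ μ₁) (hμ₂ : 0 ≤ μ₂) (hf : ContDiffAt ℝ 3 f x)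
    (h : ∀ᶠ y in 𝓝 x, HasGramValues (fderiv ℝ f y) μ₁ μ₂)
    (hs : ∀ᶠ y in 𝓝 x, Function.Surjective (fderiv ℝ f y) ∨ μ₁ = 0)
    (hmin : ∀ᶠ y in 𝓝 x, ∀ S : E →L[ℝ] E, (∀ v, S v + gramOp (fderiv ℝ f y) (S v) = v) →
      ∑ j, fderiv ℝ (fderiv ℝ f) y (S (ε j)) (ε j) = 0) :
    fderiv ℝ (fderiv ℝ f) x = 0 := by
  have hL : basisLaplacian ε f =ᶠ[𝓝 x] fun _ => 0 := by
    filter_upwards [hf.eventually (by decide), h.eventually_nhds, hs, hmin] with y hy h' hs' hm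
    have := hm ((1 + μ₁)⁻¹ • gramProj (fderiv ℝ f y) μ₂ μ₁ +
      (1 + μ₂)⁻¹ • gramProj (fderiv ℝ f y) μ₁ μ₂) (by
        intro v
        have q1 : 1 + μ₁ ≠ 0 := by positivity
        have q2 : 1 + μ₂ ≠ 0 := by positivity
        simp only [add_apply, smul_apply, map_add, map_smul, h'.self_of_nhds.gramOp_gramProj,
          h'.self_of_nhds.symm.gramOp_gramProj]
        conv_rhs => rw [← gramProj_add_gramProj (fderiv ℝ f y) hne v]
        match_scalars <;> field_simp)
    obtain ⟨h1, h2⟩ := partialLaplacian_eq_zero ε (hy.of_le (by norm_num)) hne hμ₁ hμ₂ h' hs' (by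
      rw [← this]
      simp [partialLaplacian, Finset.smul_sum, Finset.sum_add_distrib])
    rw [basisLaplacian_eq_partialLaplacian_add ε hne, h1, h2, add_zero]
  refine fderiv_fderiv_eq_zero_of_bochner ε hf ?_ ?_
  · filter_upwards [hf.eventually (by decide), h.eventually_nhds] with y hy h' u
    have h1 := sum_inner_gramProj_eq_zero ε (hy.of_le (by norm_num)) hne h' u
    have h2 := sum_inner_gramProj_eq_zero ε (hy.of_le (by norm_num)) hne.symm
      (h'.mono fun z hz => hz.symm) u
    have h3 := congrArg₂ (· + ·) h1 h2
    simp only [← Finset.sum_add_distrib] at h3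
    have h4 : ∀ j, ⟪fderiv ℝ (fderiv ℝ f) y u (ε j), fderiv ℝ f y (ε j)⟫_ℝ =
        ⟪fderiv ℝ (fderiv ℝ f) y u (gramProj (fderiv ℝ f y) μ₁ μ₂ (ε j)), fderiv ℝ f y (ε j)⟫_ℝ +
        ⟪fderiv ℝ (fderiv ℝ f) y u (gramProj (fderiv ℝ f y) μ₂ μ₁ (ε j)),
          fderiv ℝ f y (ε j)⟫_ℝ := by
      intro j
      rw [← inner_add_left, ← map_add, gramProj_add_gramProj _ hne]
    have h5 : ∀ j, ⟪fderiv ℝ (fderiv ℝ f) y u (ε j), fderiv ℝ f y (ε j)⟫_ℝ =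
        ⟪fderiv ℝ (fderiv ℝ f) y u (ε j), fderiv ℝ f y (gramProj (fderiv ℝ f y) μ₁ μ₂ (ε j))⟫_ℝ +
        ⟪fderiv ℝ (fderiv ℝ f) y u (ε j),
          fderiv ℝ f y (gramProj (fderiv ℝ f y) μ₂ μ₁ (ε j))⟫_ℝ := by
      intro j
      rw [← inner_add_right, ← map_add, gramProj_add_gramProj _ hne]
    have h6 : ∑ j, (⟪fderiv ℝ (fderiv ℝ f) y u (ε j), fderiv ℝ f y (ε j)⟫_ℝ +
        ⟪fderiv ℝ (fderiv ℝ f) y u (ε j), fderiv ℝ f y (ε j)⟫_ℝ) = 0 := by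
      rw [add_zero] at h3
      rw [← h3]
      refine Finset.sum_congr rfl fun j _ => ?_
      conv_lhs =>
        congr
        · rw [h4]
        · rw [h5]
      ring
    rw [Finset.sum_add_distrib] at h6
    linarith
  · rw [hL.fderiv_eq]
    simp

end TwoSingularValues

/-! ### Jordan angles -/

section Angles

variable {k : ℕ} {P Q : Submodule ℝ (Euc k)} {θ : ℝ}

theorem mem_angleSpace {u : Euc k} :
    u ∈ angleSpace P Q θ ↔
      u ∈ P ∧ P.starProjection (Q.starProjection u) = Real.cos θ ^ 2 • u := Iff.rfl

/-- The angle spaces span: this is the spectral theorem for the self-adjoint operator `𝒫 ∘ 𝒬`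
on `P`, whose eigenvalues lie in `[0, 1]`. -/
theorem le_of_forall_angleSpace_le {Z : Submodule ℝ (Euc k)}
    (h : ∀ θ ∈ jordanAngles P Q, angleSpace P Q θ ≤ Z) : P ≤ Z := by
  let C : P →ₗ[ℝ] P :=
    (P.orthogonalProjectionOnto ∘L Q.starProjection ∘L P.subtypeL).toLinearMap
  have hCi : ∀ u v : P, ⟪C u, v⟫_ℝ = ⟪Q.starProjection u, Q.starProjection (v : Euc k)⟫_ℝ := by
    intro u v
    have h1 : ⟪C u, v⟫_ℝ = ⟪Q.starProjection u, (v : Euc k)⟫_ℝ := by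
      change ⟪P.orthogonalProjectionOnto (Q.starProjection u), v⟫_ℝ = _
      rw [Submodule.coe_inner, ← Submodule.starProjection_apply,
        Submodule.inner_starProjection_left_eq_right, Submodule.starProjection_eq_self_iff.2 v.2]
    rw [h1, Submodule.inner_starProjection_left_eq_right,
      Submodule.inner_starProjection_left_eq_right,
      Submodule.starProjection_eq_self_iff.2 (Submodule.starProjection_apply_mem _ _)]
  have hC : C.IsSymmetric := fun u v => by
    rw [hCi, real_inner_comm, ← hCi, real_inner_comm]
  let b := hC.eigenvectorBasis rfl
  have hb : ∀ i, (b i : Euc k) ∈ Z := by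
    intro i
    have h1 : C (b i) = hC.eigenvalues rfl i • b i := by
      exact hC.apply_eigenvectorBasis rfl i
    set l := hC.eigenvalues rfl i
    have hn : ‖(b i : Euc k)‖ = 1 := b.norm_eq_one i
    have hl : l = ‖Q.starProjection (b i : Euc k)‖ ^ 2 := by
      have := hCi (b i) (b i)
      rw [h1, Submodule.coe_inner, Submodule.coe_smul, real_inner_smul_left,
        real_inner_self_eq_norm_sq, real_inner_self_eq_norm_sq, hn] at this
      simpa using this
    have hl0 : 0 ≤ l := by rw [hl]; positivity
    have hl1 : Real.sqrt l ≤ 1 := by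
      rw [hl, Real.sqrt_sq (norm_nonneg _)]
      exact (Submodule.norm_starProjection_apply_le Q _).trans hn.le
    have hcos : Real.cos (Real.arccos (Real.sqrt l)) ^ 2 = l := by
      rw [Real.cos_arccos (by linarith [Real.sqrt_nonneg l]) hl1, Real.sq_sqrt hl0]
    have hmem : (b i : Euc k) ∈ angleSpace P Q (Real.arccos (Real.sqrt l)) := by
      refine ⟨(b i).2, ?_⟩
      rw [hcos, Submodule.starProjection_apply]
      exact congrArg Subtype.val h1
    refine h _ ⟨⟨Real.arccos_nonneg _, Real.arccos_le_pi_div_two.2 (Real.sqrt_nonneg _)⟩, ?_⟩ hmem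
    rw [Submodule.ne_bot_iff]
    exact ⟨_, hmem, fun h0 => by simp [h0] at hn⟩
  intro u hu
  have : (⟨u, hu⟩ : P) = ∑ i, ⟪b i, ⟨u, hu⟩⟫_ℝ • b i := (b.sum_repr' _).symm
  have h2 := congrArg Subtype.val this
  simp only [Submodule.coe_sum, Submodule.coe_smul] at h2
  rw [h2]
  exact Submodule.sum_mem _ fun i _ => Z.smul_mem _ (hb i)

theorem angleSpace_zero : angleSpace P Q 0 = P ⊓ Q := by
  ext u
  rw [mem_angleSpace, Submodule.mem_inf]
  refine and_congr_right fun hu => ?_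
  rw [Real.cos_zero, one_pow, one_smul]
  constructor
  · intro h
    have h1 : ⟪Q.starProjection u, u⟫_ℝ = ⟪u, u⟫_ℝ := by
      rw [← Submodule.starProjection_eq_self_iff.2 hu,
        ← Submodule.inner_starProjection_left_eq_right,
        Submodule.starProjection_eq_self_iff.2 hu, h]
    rw [← Submodule.starProjection_eq_self_iff]
    have h2 : ⟪Q.starProjection u, Q.starProjection u⟫_ℝ = ⟪Q.starProjection u, u⟫_ℝ := by
      rw [Submodule.inner_starProjection_left_eq_right,
        Submodule.starProjection_eq_self_iff.2 (Submodule.starProjection_apply_mem _ _),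
        ← Submodule.inner_starProjection_left_eq_right]
    rw [← sub_eq_zero, ← inner_self_eq_zero (𝕜 := ℝ), inner_sub_left, inner_sub_right,
      inner_sub_right, h2, h1, real_inner_comm (Q.starProjection u) u, h1]
    ring
  · intro h
    rw [Submodule.starProjection_eq_self_iff.2 h, Submodule.starProjection_eq_self_iff.2 hu]

theorem angleSpace_pi_div_two_sub : angleSpace P Q (Real.pi / 2 - θ) = angleSpace P Qᗮ θ := by
  ext u
  rw [mem_angleSpace, mem_angleSpace]
  refine and_congr_right fun hu => ?_
  rw [Submodule.starProjection_orthogonal, Real.cos_pi_div_two_sub, Real.sin_sq]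
  simp only [sub_apply, ContinuousLinearMap.id_apply, map_sub,
    Submodule.starProjection_eq_self_iff.2 hu]
  rw [sub_smul, one_smul]
  constructor
  · intro h; rw [h]; abel
  · intro h; rw [← h]; abel

theorem angleSpace_pi_div_two : angleSpace P Q (Real.pi / 2) = P ⊓ Qᗮ := by
  rw [← angleSpace_zero, ← angleSpace_pi_div_two_sub, sub_zero]

theorem jordanAngles_orthogonal :
    jordanAngles P Qᗮ = (fun θ => Real.pi / 2 - θ) ⁻¹' jordanAngles P Q := by
  ext θ
  simp only [jordanAngles, Set.mem_ofPred_eq, Set.mem_preimage, angleSpace_pi_div_two_sub,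
    Set.mem_Icc]
  refine and_congr_left fun _ => ⟨?_, ?_⟩ <;> exact fun h => ⟨by linarith, by linarith⟩

theorem finrank_orthogonal_inf_orthogonal (P Q : Submodule ℝ (Euc k)) :
    finrank ℝ (Pᗮ ⊓ Qᗮ : Submodule ℝ (Euc k)) + finrank ℝ P + finrank ℝ Q =
      k + finrank ℝ (P ⊓ Q : Submodule ℝ (Euc k)) := by
  have h1 := Submodule.finrank_sup_add_finrank_inf_eq P Q
  have h2 := (P ⊔ Q).finrank_add_finrank_orthogonal
  rw [← Submodule.inf_orthogonal] at h2
  simp only [finrank_euclideanSpace, Fintype.card_fin] at h2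
  omega

theorem zero_mem_jordanAngles : (0 : ℝ) ∈ jordanAngles P Q ↔ P ⊓ Q ≠ ⊥ := by
  have : 0 ≤ Real.pi / 2 := by positivity
  simp [jordanAngles, angleSpace_zero, this]

theorem pi_div_two_mem_jordanAngles : Real.pi / 2 ∈ jordanAngles P Q ↔ P ⊓ Qᗮ ≠ ⊥ := by
  have : 0 ≤ Real.pi / 2 := by positivity
  simp [jordanAngles, angleSpace_pi_div_two, this]

/-- For an angle in the open interval, the projection of an angle vector of `(P, Q)` to `Pᗮ` is an
angle vector of `(Pᗮ, Qᗮ)`. -/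
theorem angleSpace_orthogonal_ne_bot (hc0 : Real.cos θ ^ 2 ≠ 0) (hc1 : Real.cos θ ^ 2 ≠ 1)
    (h : angleSpace P Q θ ≠ ⊥) : angleSpace Pᗮ Qᗮ θ ≠ ⊥ := by
  rw [Submodule.ne_bot_iff] at h ⊢
  obtain ⟨u, ⟨hu, hu'⟩, hu0⟩ := h
  set c := Real.cos θ ^ 2 with hc
  have hv : Pᗮ.starProjection (Q.starProjection u) = Q.starProjection u - c • u := by
    rw [Submodule.starProjection_orthogonal, sub_apply, hu']
    rfl
  refine ⟨Q.starProjection u - c • u, ⟨hv ▸ Submodule.starProjection_apply_mem _ _, ?_⟩, ?_⟩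
  · have h1 : Qᗮ.starProjection (Q.starProjection u - c • u) =
        c • (Q.starProjection u - u) := by
      rw [Submodule.starProjection_orthogonal]
      simp only [sub_apply, ContinuousLinearMap.id_apply, map_sub, map_smul,
        Submodule.starProjection_eq_self_iff.2 (Submodule.starProjection_apply_mem Q u)]
      module
    have h2 : Pᗮ.starProjection u = 0 := by
      rw [Submodule.starProjection_orthogonal, sub_apply,
        Submodule.starProjection_eq_self_iff.2 hu]
      simp
    rw [h1, map_smul, map_sub, h2, hv, sub_zero]
  · intro h0
    rw [sub_eq_zero] at h0
    have h1 := congrArg Q.starProjection h0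
    rw [Submodule.starProjection_eq_self_iff.2 (Submodule.starProjection_apply_mem Q u), map_smul,
      h0, smul_smul] at h1
    have h2 : (c * (1 - c)) • u = 0 := by
      rw [mul_sub, sub_smul, ← h1]; simp
    rcases smul_eq_zero.1 h2 with h3 | h3
    · rcases mul_eq_zero.1 h3 with h4 | h4
      · exact hc0 h4
      · exact hc1 (by linarith)
    · exact hu0 h3

theorem mem_jordanAngles_orthogonal_of_mem (hd : finrank ℝ P + finrank ℝ Qᗮ = k) (h0 : θ ≠ 0)
    (h : θ ∈ jordanAngles P Q) : θ ∈ jordanAngles Pᗮ Qᗮ := by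
  rcases eq_or_ne θ (Real.pi / 2) with rfl | h1
  · rw [pi_div_two_mem_jordanAngles] at h ⊢
    have := finrank_orthogonal_inf_orthogonal P Qᗮ
    intro hbot
    rw [hbot, finrank_bot] at this
    exact h (Submodule.finrank_eq_zero.1 (by omega))
  · have hθ := h.1
    have hpi := Real.pi_pos
    have hlt : θ < Real.pi / 2 := lt_of_le_of_ne hθ.2 h1
    have hpos : 0 < θ := lt_of_le_of_ne hθ.1 h0.symm
    have hc : 0 < Real.cos θ := Real.cos_pos_of_mem_Ioo ⟨by linarith, hlt⟩
    have hs : 0 < Real.sin θ := Real.sin_pos_of_pos_of_lt_pi hpos (by linarith)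
    refine ⟨hθ, angleSpace_orthogonal_ne_bot (by positivity) ?_ h.2⟩
    have := Real.sin_sq_add_cos_sq θ
    intro h2
    rw [h2] at this
    have : Real.sin θ ^ 2 = 0 := by linarith
    exact hs.ne' (pow_eq_zero_iff two_ne_zero |>.1 this)

end Angles

/-! ### Graphs over a linear subspace -/

section Graph

variable {k : ℕ} {E : Submodule ℝ (Euc k)} (A : E →L[ℝ] Eᗮ)

/-- The parametrization `v ↦ v + A v` of the graph of `A : E → Eᗮ`. -/
noncomputable def graphMap : E →L[ℝ] Euc k := E.subtypeL + Eᗮ.subtypeL ∘L A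

/-- The graph of `A : E → Eᗮ`. -/
noncomputable def graphPlane : Submodule ℝ (Euc k) := LinearMap.range (graphMap A).toLinearMap

/-- `real_inner_smul_left`, for the scalar multiplication of a submodule. -/
theorem Submodule.inner_smul_left' (c : ℝ) (v w : E) : ⟪c • v, w⟫_ℝ = c * ⟪v, w⟫_ℝ :=
  real_inner_smul_left v w c

theorem graphMap_apply (v : E) : graphMap A v = (v : Euc k) + (A v : Euc k) := rfl

theorem graphMap_mem (v : E) : graphMap A v ∈ graphPlane A := ⟨v, rfl⟩

@[simp] theorem orthogonalProjectionOnto_graphMap (v : E) :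
    E.orthogonalProjectionOnto (graphMap A v) = v := by
  rw [graphMap_apply, map_add, Submodule.orthogonalProjectionOnto_mem_subspace_eq_self,
    Submodule.orthogonalProjectionOnto_apply_of_mem_orthogonal (A v).2, add_zero]

theorem starProjection_graphMap (v : E) : E.starProjection (graphMap A v) = v := by
  rw [Submodule.starProjection_apply, orthogonalProjectionOnto_graphMap]

theorem inner_coe_coe_orthogonal (v : E) (y : Eᗮ) : ⟪(v : Euc k), (y : Euc k)⟫_ℝ = 0 :=
  Submodule.inner_right_of_mem_orthogonal v.2 y.2

theorem inner_graphMap_right (u : Euc k) (w : E) : ⟪u, graphMap A w⟫_ℝ =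
    ⟪E.orthogonalProjectionOnto u, w⟫_ℝ + ⟪Eᗮ.orthogonalProjectionOnto u, A w⟫_ℝ := by
  rw [graphMap_apply, inner_add_right, Submodule.coe_inner, Submodule.coe_inner,
    ← Submodule.starProjection_apply, ← Submodule.starProjection_apply,
    Submodule.inner_starProjection_left_eq_right, Submodule.inner_starProjection_left_eq_right,
    Submodule.starProjection_eq_self_iff.2 w.2, Submodule.starProjection_eq_self_iff.2 (A w).2]

theorem inner_coe_graphMap (v w : E) : ⟪(v : Euc k), graphMap A w⟫_ℝ = ⟪v, w⟫_ℝ := by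
  rw [graphMap_apply, inner_add_right, inner_coe_coe_orthogonal, add_zero]; rfl

theorem inner_coe_orthogonal_graphMap (y : Eᗮ) (w : E) :
    ⟪(y : Euc k), graphMap A w⟫_ℝ = ⟪y, A w⟫_ℝ := by
  rw [graphMap_apply, inner_add_right, real_inner_comm, inner_coe_coe_orthogonal, zero_add]; rfl

theorem inner_graphMap_graphMap (v w : E) :
    ⟪graphMap A v, graphMap A w⟫_ℝ = ⟪v, w⟫_ℝ + ⟪A v, A w⟫_ℝ := by
  conv_lhs => rw [graphMap_apply A v]
  rw [inner_add_left, inner_coe_graphMap, inner_coe_orthogonal_graphMap]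

theorem mem_orthogonal_graphPlane {u : Euc k} :
    u ∈ (graphPlane A)ᗮ ↔ E.orthogonalProjectionOnto u =
      -ContinuousLinearMap.adjoint A (Eᗮ.orthogonalProjectionOnto u) := by
  rw [Submodule.mem_orthogonal']
  have : (∀ w ∈ graphPlane A, ⟪u, w⟫_ℝ = 0) ↔ ∀ w : E, ⟪E.orthogonalProjectionOnto u +
      ContinuousLinearMap.adjoint A (Eᗮ.orthogonalProjectionOnto u), w⟫_ℝ = 0 := by
    constructor
    · intro h w
      rw [inner_add_left, ContinuousLinearMap.adjoint_inner_left, ← inner_graphMap_right]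
      exact h _ (graphMap_mem A w)
    · rintro h _ ⟨w, rfl⟩
      have := h w
      rw [inner_add_left, ContinuousLinearMap.adjoint_inner_left, ← inner_graphMap_right] at this
      exact this
  rw [this, eq_neg_iff_add_eq_zero]
  exact ⟨fun h => inner_self_eq_zero.1 (h _), fun h w => by rw [h, inner_zero_left]⟩

theorem eq_zero_of_starProjection_orthogonal_graphPlane {y : Eᗮ}
    (h : (graphPlane A)ᗮ.starProjection (y : Euc k) = 0) : y = 0 := by
  rw [Submodule.starProjection_orthogonal, sub_apply, sub_eq_zero] at h
  have h1 : (y : Euc k) ∈ graphPlane A := Submodule.starProjection_eq_self_iff.1 h.symm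
  obtain ⟨w, hw⟩ := h1
  change graphMap A w = y at hw
  have h2 : w = 0 := by
    rw [← orthogonalProjectionOnto_graphMap A w, hw]
    exact Submodule.orthogonalProjectionOnto_apply_of_mem_orthogonal y.2
  rw [h2, map_zero] at hw
  exact Subtype.ext hw.symm

/-- The conormal vector `y - A† y` of a graph. -/
theorem sub_adjoint_mem_orthogonal_graphPlane (y : Eᗮ) :
    (y : Euc k) - (ContinuousLinearMap.adjoint A y : E) ∈ (graphPlane A)ᗮ := by
  rw [Submodule.mem_orthogonal']
  rintro _ ⟨w, rfl⟩
  change ⟪_, graphMap A w⟫_ℝ = 0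
  rw [inner_sub_left, inner_coe_orthogonal_graphMap, inner_coe_graphMap,
    ContinuousLinearMap.adjoint_inner_left, sub_self]

theorem finrank_graphPlane : finrank ℝ (graphPlane A) = finrank ℝ E :=
  LinearMap.finrank_range_of_inj fun v w h => by
    rw [← orthogonalProjectionOnto_graphMap A v, ← orthogonalProjectionOnto_graphMap A w]
    exact congrArg _ h

variable {A} {θ : ℝ}

theorem one_div_cos_sq_sub_one (h : Real.cos θ ≠ 0) :
    Real.tan θ ^ 2 = (Real.cos θ ^ 2)⁻¹ - 1 := by
  rw [Real.tan_eq_sin_div_cos, div_pow, Real.sin_sq]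
  field_simp

theorem gramOp_of_mem_angleSpace (hθ : Real.cos θ ≠ 0) {u : Euc k}
    (hu : u ∈ angleSpace (graphPlane A) E θ) :
    gramOp A (E.orthogonalProjectionOnto u) =
      Real.tan θ ^ 2 • E.orthogonalProjectionOnto u := by
  obtain ⟨⟨v, rfl⟩, hu⟩ := hu
  change (graphPlane A).starProjection (E.starProjection (graphMap A v)) =
    Real.cos θ ^ 2 • graphMap A v at hu
  change gramOp A (E.orthogonalProjectionOnto (graphMap A v)) =
    _ • E.orthogonalProjectionOnto (graphMap A v)
  rw [orthogonalProjectionOnto_graphMap]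
  rw [starProjection_graphMap] at hu
  refine ext_inner_right ℝ fun w => ?_
  have h1 := congrArg (fun z => ⟪z, graphMap A w⟫_ℝ) hu
  simp only [Submodule.inner_starProjection_left_eq_right, inner_smul_left,
    Submodule.starProjection_eq_self_iff.2 (graphMap_mem A w), inner_coe_graphMap,
    inner_graphMap_graphMap, conj_trivial] at h1
  rw [inner_gramOp_left, Submodule.inner_smul_left', one_div_cos_sq_sub_one hθ]
  have h2 : Real.cos θ ^ 2 ≠ 0 := pow_ne_zero 2 hθ
  field_simp
  linarith

theorem adjoint_of_mem_angleSpace (hθ : Real.cos θ ≠ 0) {u : Euc k}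
    (hu : u ∈ angleSpace (graphPlane A)ᗮ Eᗮ θ) :
    A (ContinuousLinearMap.adjoint A (Eᗮ.orthogonalProjectionOnto u)) =
      Real.tan θ ^ 2 • Eᗮ.orthogonalProjectionOnto u := by
  obtain ⟨hu, hu'⟩ := hu
  rw [mem_orthogonal_graphPlane] at hu
  set y := Eᗮ.orthogonalProjectionOnto u with hy
  refine ext_inner_right ℝ fun z => ?_
  have h1 := congrArg (fun v => ⟪v, (z : Euc k) - (ContinuousLinearMap.adjoint A z : E)⟫_ℝ) hu'
  have e1 : ∀ v : Euc k, ⟪v, (z : Euc k) - (ContinuousLinearMap.adjoint A z : E)⟫_ℝ =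
      ⟪Eᗮ.orthogonalProjectionOnto v, z⟫_ℝ -
        ⟪E.orthogonalProjectionOnto v, ContinuousLinearMap.adjoint A z⟫_ℝ := by
    intro v
    rw [inner_sub_right, Submodule.coe_inner, Submodule.coe_inner,
      ← Submodule.starProjection_apply, ← Submodule.starProjection_apply,
      Submodule.inner_starProjection_left_eq_right, Submodule.inner_starProjection_left_eq_right,
      Submodule.starProjection_eq_self_iff.2 z.2, Submodule.starProjection_eq_self_iff.2
        (ContinuousLinearMap.adjoint A z).2]
  simp only [Submodule.inner_starProjection_left_eq_right (graphPlane A)ᗮ, real_inner_smul_left,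
    Submodule.starProjection_eq_self_iff.2 (sub_adjoint_mem_orthogonal_graphPlane A z)] at h1
  rw [e1 u, hu, ← hy, inner_sub_right, Submodule.starProjection_apply, ← hy,
    real_inner_comm _ (y : Euc k), real_inner_comm _ (y : Euc k), inner_coe_coe_orthogonal,
    sub_zero, ← Submodule.coe_inner, real_inner_comm, inner_neg_left,
    ContinuousLinearMap.adjoint_inner_right] at h1
  rw [real_inner_smul_left, one_div_cos_sq_sub_one hθ]
  have h2 : Real.cos θ ^ 2 ≠ 0 := pow_ne_zero 2 hθ
  field_simp
  linarith

theorem isometric_of_jordanAngles (hθ : Real.cos θ ≠ 0)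
    (h : jordanAngles (graphPlane A) E = {θ}) (v w : E) :
    ⟪A v, A w⟫_ℝ = Real.tan θ ^ 2 * ⟪v, w⟫_ℝ := by
  let Z : Submodule ℝ (Euc k) := LinearMap.ker
    ((gramOp A - Real.tan θ ^ 2 • ContinuousLinearMap.id ℝ E) ∘L
      E.orthogonalProjectionOnto).toLinearMap
  have hZ : graphPlane A ≤ Z := le_of_forall_angleSpace_le (Q := E) fun t ht u hu => by
    rw [h] at ht
    obtain rfl : t = θ := ht
    exact sub_eq_zero.2 (gramOp_of_mem_angleSpace hθ hu)
  have h1 : gramOp A (E.orthogonalProjectionOnto (graphMap A v)) -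
    Real.tan θ ^ 2 • E.orthogonalProjectionOnto (graphMap A v) = 0 := hZ (graphMap_mem A v)
  rw [orthogonalProjectionOnto_graphMap, sub_eq_zero] at h1
  rw [← inner_gramOp_left, h1, Submodule.inner_smul_left']

theorem coisometric_of_jordanAngles (hθ : Real.cos θ ≠ 0)
    (h : jordanAngles (graphPlane A)ᗮ Eᗮ = {θ}) (y z : Eᗮ) :
    ⟪ContinuousLinearMap.adjoint A y, ContinuousLinearMap.adjoint A z⟫_ℝ =
      Real.tan θ ^ 2 * ⟪y, z⟫_ℝ := by
  let Z : Submodule ℝ (Euc k) := LinearMap.ker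
    ((A ∘L ContinuousLinearMap.adjoint A - Real.tan θ ^ 2 • ContinuousLinearMap.id ℝ Eᗮ) ∘L
      Eᗮ.orthogonalProjectionOnto).toLinearMap
  have hZ : (graphPlane A)ᗮ ≤ Z := le_of_forall_angleSpace_le (Q := Eᗮ) fun t ht u hu => by
    rw [h] at ht
    obtain rfl : t = θ := ht
    exact sub_eq_zero.2 (adjoint_of_mem_angleSpace hθ hu)
  have h1 := hZ (sub_adjoint_mem_orthogonal_graphPlane A y)
  have h2 : Eᗮ.orthogonalProjectionOnto
      ((y : Euc k) - (ContinuousLinearMap.adjoint A y : E)) = y := by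
    rw [map_sub, Submodule.orthogonalProjectionOnto_mem_subspace_eq_self,
      Submodule.orthogonalProjectionOnto_orthogonal_apply_eq_zero
        (ContinuousLinearMap.adjoint A y).2, sub_zero]
  have h3 : A (ContinuousLinearMap.adjoint A (Eᗮ.orthogonalProjectionOnto
      ((y : Euc k) - (ContinuousLinearMap.adjoint A y : E)))) -
    Real.tan θ ^ 2 • Eᗮ.orthogonalProjectionOnto
      ((y : Euc k) - (ContinuousLinearMap.adjoint A y : E)) = 0 := h1
  rw [h2, sub_eq_zero] at h3
  rw [ContinuousLinearMap.adjoint_inner_right, h3, real_inner_smul_left]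

theorem hasGramValues_of_jordanAngles {θ₁ θ₂ : ℝ} (hθ₁ : Real.cos θ₁ ≠ 0) (hθ₂ : Real.cos θ₂ ≠ 0)
    (h : jordanAngles (graphPlane A) E = {θ₁, θ₂}) :
    HasGramValues A (Real.tan θ₁ ^ 2) (Real.tan θ₂ ^ 2) := by
  intro v
  set μ₁ := Real.tan θ₁ ^ 2 with h₁
  set μ₂ := Real.tan θ₂ ^ 2 with h₂
  let Z : Submodule ℝ (Euc k) := LinearMap.ker
    ((gramOp A ∘L gramOp A - (μ₁ + μ₂) • gramOp A + (μ₁ * μ₂) • ContinuousLinearMap.id ℝ E) ∘L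
      E.orthogonalProjectionOnto).toLinearMap
  have hZ : graphPlane A ≤ Z := le_of_forall_angleSpace_le (Q := E) fun t ht u hu => by
    have hc : Real.cos t ≠ 0 ∧ (Real.tan t ^ 2 = μ₁ ∨ Real.tan t ^ 2 = μ₂) := by
      rw [h] at ht
      rcases ht with rfl | rfl
      · exact ⟨hθ₁, Or.inl rfl⟩
      · exact ⟨hθ₂, Or.inr rfl⟩
    have h3 := gramOp_of_mem_angleSpace hc.1 hu
    change gramOp A (gramOp A (E.orthogonalProjectionOnto u)) -
      (μ₁ + μ₂) • gramOp A (E.orthogonalProjectionOnto u) +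
      (μ₁ * μ₂) • E.orthogonalProjectionOnto u = 0
    rw [h3, map_smul, h3]
    rcases hc.2 with h4 | h4 <;> rw [h4] <;> module
  have h1 : gramOp A (gramOp A (E.orthogonalProjectionOnto (graphMap A v))) -
      (μ₁ + μ₂) • gramOp A (E.orthogonalProjectionOnto (graphMap A v)) +
      (μ₁ * μ₂) • E.orthogonalProjectionOnto (graphMap A v) = 0 := hZ (graphMap_mem A v)
  rw [orthogonalProjectionOnto_graphMap] at h1
  rw [← sub_eq_zero, ← h1]
  abel

end Graph

/-! ### Local graph representations of a submanifold -/

section GraphChart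

variable {n k : ℕ} {M : Type*} [TopologicalSpace M]

/-- Near `x`, the map `ψ : E → M` is a smooth local inverse of `q ↦ 𝒫_E (F q)`; equivalently, `ψ`
exhibits `F` near `ψ x` as the graph over `E` of `y ↦ 𝒫_{Eᗮ} (F (ψ y))`. -/
structure IsGraphChart (F : M → Euc k) (E : Submodule ℝ (Euc k)) (ψ : E → M) (x : E) : Prop where
  right_inv : ∀ᶠ y in 𝓝 x, E.orthogonalProjectionOnto (F (ψ y)) = y
  left_inv : ∀ᶠ q in 𝓝 (ψ x), ψ (E.orthogonalProjectionOnto (F q)) = q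
  contDiffAt : ContDiffAt ℝ 3 (F ∘ ψ) x

/-- The function `E → Eᗮ` of which `F` is the graph, in the chart `ψ`. -/
noncomputable def graphFun (F : M → Euc k) (E : Submodule ℝ (Euc k)) (ψ : E → M) (y : E) : Eᗮ :=
  Eᗮ.orthogonalProjectionOnto (F (ψ y))

variable [ChartedSpace (Euc n) M] {F : M → Euc k} {E : Submodule ℝ (Euc k)}

/-- The inverse function theorem: a submanifold is a graph over `E` near each point at which its
tangent plane is transverse to `Eᗮ`. -/
theorem exists_isGraphChart (hF : IsSmoothImmersion n F)
    (hE : finrank ℝ E = n) (p : M)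
    (hp : tangentPlane n F p ⊓ Eᗮ = ⊥) :
    ∃ ψ : E → M, ψ (E.orthogonalProjectionOnto (F p)) = p ∧
      ∀ᶠ y in 𝓝 (E.orthogonalProjectionOnto (F p)), IsGraphChart F E ψ y := by
  set c := extChartAt (𝓡 n) p with hc
  set y₀ : Euc n := c p with hy₀
  have hFt : ContDiffAt ℝ ∞ (F ∘ c.symm) y₀ := by
    have := (contMDiffAt_iff.1 (hF.1 p)).2
    rw [ModelWithCorners.range_eq_univ, contDiffWithinAt_univ] at this
    exact this
  have hdF : mfderiv (𝓡 n) 𝓘(ℝ, Euc k) F p = fderiv ℝ (F ∘ c.symm) y₀ := by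
    have hd : MDifferentiableAt (𝓡 n) 𝓘(ℝ, Euc k) F p := (hF.1 p).mdifferentiableAt (by simp)
    rw [hd.mfderiv, ModelWithCorners.range_eq_univ, fderivWithin_univ]
    rfl
  set g : Euc n → E := fun y => E.orthogonalProjectionOnto ((F ∘ c.symm) y) with hg
  have hgs : ContDiffAt ℝ ∞ g y₀ := E.orthogonalProjectionOnto.contDiff.contDiffAt.comp y₀ hFt
  have hcp : c.symm y₀ = p := extChartAt_to_inv (I := 𝓡 n) p
  have hg₀ : g y₀ = E.orthogonalProjectionOnto (F p) := by simp [hg, hcp]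
  have hgd : HasFDerivAt g (E.orthogonalProjectionOnto ∘L fderiv ℝ (F ∘ c.symm) y₀) y₀ :=
    E.orthogonalProjectionOnto.hasFDerivAt.comp y₀
      (hFt.differentiableAt (by simp)).hasFDerivAt
  have hinj : Function.Injective
      (E.orthogonalProjectionOnto ∘L fderiv ℝ (F ∘ c.symm) y₀).toLinearMap := by
    rw [← LinearMap.ker_eq_bot, LinearMap.ker_eq_bot']
    intro v hv
    have h1 : fderiv ℝ (F ∘ c.symm) y₀ v ∈ tangentPlane n F p ⊓ Eᗮ := by
      refine ⟨⟨v, ?_⟩, Submodule.orthogonalProjectionOnto_eq_zero_iff.1 hv⟩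
      change mfderiv (𝓡 n) 𝓘(ℝ, Euc k) F p v = _
      rw [hdF]
      rfl
    rw [hp, Submodule.mem_bot, ← hdF] at h1
    exact hF.2 p (h1.trans (map_zero (mfderiv (𝓡 n) 𝓘(ℝ, Euc k) F p)).symm)
  let e : Euc n ≃L[ℝ] E := (LinearEquiv.ofInjectiveOfFinrankEq _ hinj
    (by rw [hE]; simp)).toContinuousLinearEquiv
  have hge : HasFDerivAt g (e : Euc n →L[ℝ] E) y₀ := by
    exact hgd
  have hne : (∞ : ℕ∞ω) ≠ 0 := by simp
  let G := hgs.toOpenPartialHomeomorph g hge hne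
  have hGs : y₀ ∈ G.source := hgs.mem_toOpenPartialHomeomorph_source hge hne
  have hG : ∀ y, G y = g y := fun y => rfl
  have hinv : ContDiffAt ℝ ∞ G.symm (g y₀) := hgs.to_localInverse hge hne
  have hinv₀ : G.symm (g y₀) = y₀ := G.left_inv hGs
  let ψ : E → M := fun x => c.symm (G.symm x)
  have hψ₀ : ψ (g y₀) = p := by simp [ψ, hinv₀, hcp]
  have h1 : ∀ᶠ y in 𝓝 (g y₀), E.orthogonalProjectionOnto (F (ψ y)) = y := by
    filter_upwards [G.open_target.mem_nhds (G.map_source hGs)] with y hy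
    exact G.right_inv hy
  have hc0 : Tendsto c (𝓝 p) (𝓝 y₀) := continuousAt_extChartAt (I := 𝓡 n) p
  have h2 : ∀ᶠ q in 𝓝 p, ψ (E.orthogonalProjectionOnto (F q)) = q := by
    filter_upwards [extChartAt_source_mem_nhds (I := 𝓡 n) p,
      hc0 (G.open_source.mem_nhds hGs)] with q hq hq'
    have h3 : c.symm (c q) = q := c.left_inv hq
    have h4 : E.orthogonalProjectionOnto (F q) = G (c q) := by
      rw [hG]
      simp only [hg, Function.comp_apply, h3]
    change c.symm (G.symm _) = q
    rw [h4, G.left_inv hq', h3]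
  have h3 : ContDiffAt ℝ 3 (F ∘ ψ) (g y₀) := by
    have h := hFt
    rw [← hinv₀] at h
    exact contDiffAt_infty.1 (h.comp (g y₀) hinv) 3
  have h4 : Tendsto ψ (𝓝 (g y₀)) (𝓝 p) := by
    have h5 : Tendsto c.symm (𝓝 y₀) (𝓝 p) := by
      have := (continuousAt_extChartAt_symm (I := 𝓡 n) p)
      rw [ContinuousAt, extChartAt_to_inv] at this
      exact this
    have h6 : Tendsto G.symm (𝓝 (g y₀)) (𝓝 y₀) := by
      have := hinv.continuousAt
      rw [ContinuousAt, hinv₀] at this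
      exact this
    exact h5.comp h6
  rw [← hg₀]
  refine ⟨ψ, hψ₀, ?_⟩
  filter_upwards [h1.eventually_nhds, h4.eventually h2.eventually_nhds,
    h3.eventually (by decide)] with y a b d
  exact ⟨a, b, d⟩

end GraphChart

/-! ### Ambient derivatives and tangent planes in a graph chart -/

section Curvature

variable {n k : ℕ} {M : Type*} [TopologicalSpace M]
  {F : M → Euc k} {E : Submodule ℝ (Euc k)} {ψ : E → M} {x : E}

theorem IsGraphChart.contDiffAt_graphFun (h : IsGraphChart F E ψ x) :
    ContDiffAt ℝ 3 (graphFun F E ψ) x :=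
  Eᗮ.orthogonalProjectionOnto.contDiff.contDiffAt.comp x h.contDiffAt

theorem IsGraphChart.eventuallyEq (h : IsGraphChart F E ψ x) :
    F ∘ ψ =ᶠ[𝓝 x] fun y => (y : Euc k) + (graphFun F E ψ y : Euc k) := by
  filter_upwards [h.right_inv] with y hy
  have h1 := E.starProjection_add_starProjection_orthogonal (F (ψ y))
  rw [Submodule.starProjection_apply, Submodule.starProjection_apply, hy] at h1
  exact h1.symm

theorem IsGraphChart.hasFDerivAt (h : IsGraphChart F E ψ x) :
    HasFDerivAt (F ∘ ψ) (graphMap (fderiv ℝ (graphFun F E ψ) x)) x := by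
  have h1 : HasFDerivAt (fun y : E => (y : Euc k) + (graphFun F E ψ y : Euc k))
      (graphMap (fderiv ℝ (graphFun F E ψ) x)) x :=
    E.subtypeL.hasFDerivAt.add (Eᗮ.subtypeL.hasFDerivAt.comp x
      (h.contDiffAt_graphFun.differentiableAt (by simp)).hasFDerivAt)
  exact h1.congr_of_eventuallyEq h.eventuallyEq

variable [ChartedSpace (Euc n) M]

/-- The ambient derivative of a field is the derivative of its expression in a graph chart. -/
theorem IsGraphChart.ambientDeriv_eq (h : IsGraphChart F E ψ x) (hF : IsSmoothImmersion n F)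
    {Y : M → Euc k} (hY : DifferentiableAt ℝ (Y ∘ ψ) x) (u : tangentPlane n F (ψ x)) :
    ambientDeriv n F Y (ψ x) u =
      fderiv ℝ (Y ∘ ψ) x (E.orthogonalProjectionOnto (u : Euc k)) := by
  have hFd : MDifferentiableAt (𝓡 n) 𝓘(ℝ, Euc k) F (ψ x) := (hF.1 (ψ x)).mdifferentiableAt (by simp)
  set Φ : Euc k → Euc k := fun z => (Y ∘ ψ) (E.orthogonalProjectionOnto z) with hΦ
  have hx : E.orthogonalProjectionOnto (F (ψ x)) = x := h.right_inv.self_of_nhds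
  have hΦd : HasFDerivAt Φ (fderiv ℝ (Y ∘ ψ) x ∘L E.orthogonalProjectionOnto) (F (ψ x)) := by
    have hY' := hY.hasFDerivAt
    rw [← hx] at hY'
    have := hY'.comp (F (ψ x)) E.orthogonalProjectionOnto.hasFDerivAt
    rw [hx] at this
    exact this
  have hYΦ : Y =ᶠ[𝓝 (ψ x)] Φ ∘ F := by
    filter_upwards [h.left_inv] with q hq
    simp only [hΦ, Function.comp_apply, hq]
  have h1 : mfderiv (𝓡 n) 𝓘(ℝ, Euc k) Y (ψ x) =
      (fderiv ℝ (Y ∘ ψ) x ∘L E.orthogonalProjectionOnto) ∘L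
        (mfderiv (𝓡 n) 𝓘(ℝ, Euc k) F (ψ x)) := by
    rw [hYΦ.mfderiv_eq, mfderiv_comp (ψ x) hΦd.differentiableAt.mdifferentiableAt hFd,
      mfderiv_eq_fderiv, hΦd.fderiv]
    rfl
  have h2 : mfderiv (𝓡 n) 𝓘(ℝ, Euc k) F (ψ x) (tangentLift n F (ψ x) u) = (u : Euc k) := by
    have := Function.surjInv_eq (differentialAt n F (ψ x)).surjective_rangeRestrict u
    exact congrArg Subtype.val this
  change mfderiv (𝓡 n) 𝓘(ℝ, Euc k) Y (ψ x) (tangentLift n F (ψ x) u) = _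
  rw [h1]
  change fderiv ℝ (Y ∘ ψ) x (E.orthogonalProjectionOnto
    (mfderiv (𝓡 n) 𝓘(ℝ, Euc k) F (ψ x) (tangentLift n F (ψ x) u))) = _
  rw [h2]

theorem finrank_tangentPlane (hF : IsSmoothImmersion n F) (p : M) :
    finrank ℝ (tangentPlane n F p) = n := by
  rw [tangentPlane, LinearMap.finrank_range_of_inj (hF.2 p)]
  exact finrank_euclideanSpace_fin

theorem IsGraphChart.tangentPlane_eq (h : IsGraphChart F E ψ x) (hF : IsSmoothImmersion n F)
    (hE : finrank ℝ E = n) :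
    tangentPlane n F (ψ x) = graphPlane (fderiv ℝ (graphFun F E ψ) x) := by
  refine Submodule.eq_of_le_of_finrank_eq ?_ ?_
  · intro u hu
    have h1 := h.ambientDeriv_eq hF h.hasFDerivAt.differentiableAt ⟨u, hu⟩
    rw [h.hasFDerivAt.fderiv] at h1
    have h2 : ambientDeriv n F F (ψ x) ⟨u, hu⟩ = u :=
      congrArg Subtype.val (Function.surjInv_eq
        (differentialAt n F (ψ x)).surjective_rangeRestrict ⟨u, hu⟩)
    rw [h2] at h1
    rw [h1]
    exact graphMap_mem _ _
  · rw [finrank_tangentPlane hF, finrank_graphPlane, hE]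

end Curvature

/-! ### The orthogonal projection onto a graph -/

section GraphProjection

variable {k : ℕ} {E : Submodule ℝ (Euc k)}

theorem adjoint_graphMap_graphMap (A : E →L[ℝ] Eᗮ) (v : E) :
    ContinuousLinearMap.adjoint (graphMap A) (graphMap A v) = v + gramOp A v := by
  refine ext_inner_right ℝ fun w => ?_
  rw [ContinuousLinearMap.adjoint_inner_left, inner_graphMap_graphMap, inner_add_left,
    inner_gramOp_left]

/-- The orthogonal projection onto a graph is `J (J† J)⁻¹ J†`. -/
theorem starProjection_graphPlane (A : E →L[ℝ] Eᗮ) {S : E →L[ℝ] E}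
    (hS : ∀ v, S v + gramOp A (S v) = v) (u : Euc k) :
    (graphPlane A).starProjection u =
      graphMap A (S (ContinuousLinearMap.adjoint (graphMap A) u)) := by
  refine Submodule.eq_starProjection_of_mem_of_inner_eq_zero (graphMap_mem A _) ?_
  rintro _ ⟨w, rfl⟩
  change ⟪_, graphMap A w⟫_ℝ = 0
  rw [inner_sub_left, ← ContinuousLinearMap.adjoint_inner_left,
    ← ContinuousLinearMap.adjoint_inner_left, adjoint_graphMap_graphMap, hS, sub_self]

theorem isUnit_one_add_gramOp (A : E →L[ℝ] Eᗮ) : IsUnit (1 + gramOp A) := by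
  rw [ContinuousLinearMap.isUnit_iff_bijective]
  have hi : Function.Injective (1 + gramOp A).toLinearMap := by
    rw [← LinearMap.ker_eq_bot, LinearMap.ker_eq_bot']
    intro v hv
    have h1 : v + gramOp A v = 0 := hv
    have h2 := congrArg (fun z => ⟪z, v⟫_ℝ) h1
    simp only [inner_add_left, inner_gramOp_left, inner_zero_left] at h2
    have h3 : ⟪v, v⟫_ℝ = 0 := by
      linarith [real_inner_self_nonneg (x := v), real_inner_self_nonneg (x := A v)]
    exact inner_self_eq_zero.1 h3
  exact ⟨hi, LinearMap.injective_iff_surjective.1 hi⟩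

theorem ringInverse_one_add_gramOp (A : E →L[ℝ] Eᗮ) (v : E) :
    Ring.inverse (1 + gramOp A) v + gramOp A (Ring.inverse (1 + gramOp A) v) = v :=
  congrArg (fun L : E →L[ℝ] E => L v) (Ring.mul_inverse_cancel _ (isUnit_one_add_gramOp A))

end GraphProjection

/-! ### Second fundamental form and mean curvature in a graph chart -/

section MeanCurvature

variable {n k : ℕ} {M : Type*} [TopologicalSpace M]
  {F : M → Euc k} {E : Submodule ℝ (Euc k)} {ψ : E → M} {x : E}

theorem adjoint_graphMap_coe (A : E →L[ℝ] Eᗮ) (v : E) :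
    ContinuousLinearMap.adjoint (graphMap A) (v : Euc k) = v := by
  refine ext_inner_right ℝ fun w => ?_
  rw [ContinuousLinearMap.adjoint_inner_left, inner_coe_graphMap]

theorem hasFDerivAt_graphMap {A : E → E →L[ℝ] Eᗮ} {A' : E →L[ℝ] E →L[ℝ] Eᗮ}
    (hA : HasFDerivAt A A' x) (z : E) :
    HasFDerivAt (fun y => graphMap (A y) z) (Eᗮ.subtypeL ∘L A'.flip z) x := by
  have h1 := hA.clm_apply (hasFDerivAt_const z x)
  rw [ContinuousLinearMap.comp_zero, zero_add] at h1
  exact (Eᗮ.subtypeL.hasFDerivAt.comp x h1).const_add (z : Euc k)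

theorem differentiableAt_graphMap {A : E → E →L[ℝ] Eᗮ} (hA : DifferentiableAt ℝ A x) :
    DifferentiableAt ℝ (fun y => graphMap (A y)) x :=
  (differentiableAt_const (𝕜 := ℝ) E.subtypeL).add
    ((differentiableAt_const (𝕜 := ℝ) Eᗮ.subtypeL).clm_comp hA)

/-- The orthogonal projection onto the graph of `A`, in a form that is visibly smooth in `A`. -/
noncomputable def graphProj (A : E →L[ℝ] Eᗮ) : Euc k →L[ℝ] Euc k :=
  graphMap A ∘L Ring.inverse (1 + gramOp A) ∘L realAdjoint _ _ (graphMap A)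

theorem graphProj_apply (A : E →L[ℝ] Eᗮ) (u : Euc k) :
    graphProj A u = (graphPlane A).starProjection u :=
  (starProjection_graphPlane A (ringInverse_one_add_gramOp A) u).symm

theorem differentiableAt_graphProj {A : E → E →L[ℝ] Eᗮ} (hA : DifferentiableAt ℝ A x) :
    DifferentiableAt ℝ (fun y => graphProj (A y)) x := by
  have hJ := differentiableAt_graphMap hA
  exact hJ.clm_comp ((differentiableAt_inverse_one_add_gramOp hA
    (isUnit_one_add_gramOp (A x))).clm_comp (differentiableAt_realAdjoint hJ))

variable [ChartedSpace (Euc n) M]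

/-- In a graph chart, `B(J w, J z)` is the normal component of the Hessian `D²f(w, z)`. -/
theorem secondFundamentalForm_eq (h : ∀ᶠ y in 𝓝 x, IsGraphChart F E ψ y)
    (hF : IsSmoothImmersion n F) (hE : finrank ℝ E = n) (u v : tangentPlane n F (ψ x)) :
    secondFundamentalForm n F (ψ x) u v = (normalPlane n F (ψ x)).starProjection
      (fderiv ℝ (fderiv ℝ (graphFun F E ψ)) x (E.orthogonalProjectionOnto (u : Euc k))
        (E.orthogonalProjectionOnto (v : Euc k)) : Euc k) := by
  have hx := h.self_of_nhds
  have hf := hx.contDiffAt_graphFun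
  have d1 : DifferentiableAt ℝ (fderiv ℝ (graphFun F E ψ)) x :=
    (hf.of_le (by norm_num : (2 : ℕ∞ω) ≤ 3)).differentiableAt_fderiv
  set A := fderiv ℝ (graphFun F E ψ) with hA
  have dP := (differentiableAt_graphProj d1).hasFDerivAt
  have hT := hx.tangentPlane_eq hF hE
  obtain ⟨u, hu⟩ := u
  obtain ⟨v, hv⟩ := v
  have hvz : graphMap (A x) (E.orthogonalProjectionOnto v) = v := by
    rw [hT] at hv
    obtain ⟨z, rfl⟩ := hv
    exact congrArg _ (orthogonalProjectionOnto_graphMap _ _)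
  set w := E.orthogonalProjectionOnto u
  set z := E.orthogonalProjectionOnto v
  have e1 : (fun q => (tangentPlane n F q).starProjection v) ∘ ψ =ᶠ[𝓝 x]
      fun y => graphProj (A y) v := by
    filter_upwards [h] with y hy
    rw [graphProj_apply, Function.comp_apply, hy.tangentPlane_eq hF hE]
  have dPv : HasFDerivAt (fun y => graphProj (A y) v) _ x :=
    dP.clm_apply (hasFDerivAt_const v x)
  have d2 := dPv.congr_of_eventuallyEq e1
  -- differentiating `Π J z = J z`, where `Π` is the projection onto the graph
  have e2 : (fun y => graphProj (A y) (graphMap (A y) z)) = fun y => graphMap (A y) z := by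
    funext y
    rw [graphProj_apply, Submodule.starProjection_eq_self_iff.2 (graphMap_mem _ _)]
  have dJ := hasFDerivAt_graphMap d1.hasFDerivAt z
  have e3 := (dP.clm_apply dJ)
  rw [e2] at e3
  have e4 := congrArg (fun L : E →L[ℝ] Euc k => L w) (e3.unique dJ)
  have e5 : graphProj (A x) (fderiv ℝ A x w z : Euc k) +
      fderiv ℝ (fun y => graphProj (A y)) x w v = (fderiv ℝ A x w z : Euc k) := by
    rw [← hvz]
    exact e4
  have e6 : ambientDeriv n F (fun q => (tangentPlane n F q).starProjection v) (ψ x) ⟨u, hu⟩ =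
      fderiv ℝ (fun y => graphProj (A y)) x w v := by
    rw [hx.ambientDeriv_eq hF d2.differentiableAt, d2.fderiv]
    simp [w]
  change (normalPlane n F (ψ x)).starProjection (ambientDeriv n F
    (fun q => (tangentPlane n F q).starProjection v) (ψ x) ⟨u, hu⟩) = _
  rw [e6]
  have e7 : fderiv ℝ (fun y => graphProj (A y)) x w v =
      (normalPlane n F (ψ x)).starProjection (fderiv ℝ A x w z : Euc k) := by
    rw [normalPlane, Submodule.starProjection_orthogonal, hT, sub_apply, ← graphProj_apply,
      eq_sub_iff_add_eq, add_comm, e5]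
    rfl
  rw [e7, Submodule.starProjection_eq_self_iff.2 (Submodule.starProjection_apply_mem _ _)]

/-- In a graph chart, `H` is the normal component of the trace of the Hessian against the inverse
`S` of the induced metric `1 + A† A`. -/
theorem meanCurvature_eq {ι : Type*} [Fintype ι] (ε : OrthonormalBasis ι ℝ E)
    (h : ∀ᶠ y in 𝓝 x, IsGraphChart F E ψ y)
    (hF : IsSmoothImmersion n F) (hE : finrank ℝ E = n) {S : E →L[ℝ] E}
    (hS : ∀ v, S v + gramOp (fderiv ℝ (graphFun F E ψ) x) (S v) = v) :
    meanCurvature n F (ψ x) = (graphPlane (fderiv ℝ (graphFun F E ψ) x))ᗮ.starProjection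
      (∑ j, fderiv ℝ (fderiv ℝ (graphFun F E ψ)) x (S (ε j)) (ε j) : Eᗮ) := by
  have hT := h.self_of_nhds.tangentPlane_eq hF hE
  set T := tangentPlane n F (ψ x)
  let C : T →L[ℝ] E := E.orthogonalProjectionOnto ∘L T.subtypeL
  have hC : ∀ v : E, C (ContinuousLinearMap.adjoint C v) = S v := by
    intro v
    have h1 : (ContinuousLinearMap.adjoint C v : Euc k) = T.starProjection v := by
      simp [C, ContinuousLinearMap.adjoint_comp, Submodule.adjoint_subtypeL,
        Submodule.adjoint_orthogonalProjectionOnto]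
    change E.orthogonalProjectionOnto (ContinuousLinearMap.adjoint C v : Euc k) = _
    rw [h1, hT, starProjection_graphPlane _ hS, orthogonalProjectionOnto_graphMap,
      adjoint_graphMap_coe]
  have h2 := sum_bilin_map_orthonormalBasis (fderiv ℝ (fderiv ℝ (graphFun F E ψ)) x) C
    (stdOrthonormalBasis ℝ T) ε
  simp only [hC] at h2
  rw [← h2, Submodule.coe_sum, map_sum, ← hT]
  change ∑ i, secondFundamentalForm n F (ψ x) (stdOrthonormalBasis ℝ T i)
    (stdOrthonormalBasis ℝ T i) = _
  refine Finset.sum_congr rfl fun i _ => ?_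
  rw [secondFundamentalForm_eq h hF hE]
  rfl

/-- Parallel mean curvature in a graph chart. -/
theorem starProjection_fderiv_meanCurvature_eq_zero (h : IsGraphChart F E ψ x)
    (hF : IsSmoothImmersion n F) (hE : finrank ℝ E = n) (hH : HasParallelMeanCurvature n F)
    {H' : E →L[ℝ] Euc k} (hd : HasFDerivAt (meanCurvature n F ∘ ψ) H' x) (w : E) :
    (graphPlane (fderiv ℝ (graphFun F E ψ) x))ᗮ.starProjection (H' w) = 0 := by
  have hT := h.tangentPlane_eq hF hE
  have hw : graphMap (fderiv ℝ (graphFun F E ψ) x) w ∈ tangentPlane n F (ψ x) := by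
    rw [hT]; exact graphMap_mem _ _
  have h1 := hH (ψ x) ⟨_, hw⟩
  have hN : normalPlane n F (ψ x) = (graphPlane (fderiv ℝ (graphFun F E ψ) x))ᗮ :=
    congrArg _ hT
  rw [normalConnection, h.ambientDeriv_eq hF hd.differentiableAt, hd.fderiv,
    orthogonalProjectionOnto_graphMap] at h1
  simp only [hN] at h1
  exact h1

end MeanCurvature

/-! ### From flat graphs to affine submanifolds -/

section Affine

theorem eventually_eq_of_fderiv_eq_zero {X Y : Type*} [NormedAddCommGroup X] [NormedSpace ℝ X]
    [NormedAddCommGroup Y] [NormedSpace ℝ Y] {f : X → Y} {x : X}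
    (hd : ∀ᶠ y in 𝓝 x, DifferentiableAt ℝ f y) (h : ∀ᶠ y in 𝓝 x, fderiv ℝ f y = 0) :
    ∀ᶠ y in 𝓝 x, f y = f x := by
  obtain ⟨r, hr, hb⟩ := Metric.eventually_nhds_iff_ball.1 (hd.and h)
  filter_upwards [Metric.ball_mem_nhds x hr] with y hy
  exact Metric.isOpen_ball.is_const_of_fderiv_eq_zero (𝕜 := ℝ)
    (convex_ball x r).isPreconnected
    (fun z hz => (hb z hz).1.differentiableWithinAt) (fun z hz => (hb z hz).2) hy
    (Metric.mem_ball_self hr)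

variable {n k : ℕ} {M : Type*} [TopologicalSpace M] [ChartedSpace (Euc n) M]
  [ConnectedSpace M] {F : M → Euc k} {E : Submodule ℝ (Euc k)}

/-- A connected submanifold with constant tangent plane `E` projects to an open subset of `E`, and
its projection to `Eᗮ` is constant. -/
theorem isAffineLinear_of_tangentPlane_eq (hF : IsSmoothImmersion n F)
    (h : ∀ p, tangentPlane n F p = E) : IsAffineLinear n F := by
  obtain ⟨p₀⟩ : Nonempty M := inferInstance
  have hE : finrank ℝ E = n := by rw [← h p₀, finrank_tangentPlane hF]
  have hchart := fun p => exists_isGraphChart hF hE p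
    (by rw [h p]; exact E.inf_orthogonal_eq_bot)
  have hF0 : Continuous F := hF.1.continuous
  -- over `E` itself, the submanifold is locally the graph of a constant
  have hconst : IsLocallyConstant fun q => Eᗮ.orthogonalProjectionOnto (F q) := by
    rw [IsLocallyConstant.iff_eventually_eq]
    intro p
    obtain ⟨ψ, hψ, hc⟩ := hchart p
    have h1 := eventually_eq_of_fderiv_eq_zero
      (hc.mono fun y hy => hy.contDiffAt_graphFun.differentiableAt (by simp))
      (hc.mono fun y hy => by
        ext1 w
        have h2 := graphMap_mem (fderiv ℝ (graphFun F E ψ) y) w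
        rw [← hy.tangentPlane_eq hF hE, h] at h2
        rw [graphMap_apply, Submodule.add_mem_iff_right _ w.2] at h2
        exact Subtype.ext (inner_self_eq_zero.1
          (Submodule.inner_right_of_mem_orthogonal h2
            (fderiv ℝ (graphFun F E ψ) y w).2 : ⟪_, _⟫_ℝ = 0)))
    have hcont : Tendsto (fun q => E.orthogonalProjectionOnto (F q)) (𝓝 p)
      (𝓝 (E.orthogonalProjectionOnto (F p))) :=
      (E.orthogonalProjectionOnto.continuous.comp hF0).continuousAt
    have hinv := hc.self_of_nhds.left_inv
    rw [hψ] at hinv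
    filter_upwards [hinv, hcont.eventually h1] with q hq hq1
    simp only [graphFun, hq, hψ] at hq1
    exact hq1
  have hall : ∀ q, Eᗮ.orthogonalProjectionOnto (F q) = Eᗮ.orthogonalProjectionOnto (F p₀) :=
    fun q => hconst.apply_eq_of_isPreconnected isPreconnected_univ (Set.mem_univ _)
      (Set.mem_univ _)
  refine ⟨AffineSubspace.mk' (F p₀) E, by rw [AffineSubspace.direction_mk', hE],
    E.orthogonalProjectionOnto ⁻¹' Set.range fun q => E.orthogonalProjectionOnto (F q), ?_, ?_⟩
  · refine IsOpen.preimage E.orthogonalProjectionOnto.continuous (isOpen_iff_mem_nhds.2 ?_)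
    rintro _ ⟨p, rfl⟩
    obtain ⟨ψ, hψ, hc⟩ := hchart p
    filter_upwards [hc.self_of_nhds.right_inv] with y hy
    exact ⟨ψ y, hy⟩
  · have hmem : ∀ y, y ∈ AffineSubspace.mk' (F p₀) E ↔
        Eᗮ.orthogonalProjectionOnto y = Eᗮ.orthogonalProjectionOnto (F p₀) := by
      intro y
      rw [AffineSubspace.mem_mk', vsub_eq_sub, ← sub_eq_zero (a := Eᗮ.orthogonalProjectionOnto y),
        ← map_sub, Submodule.orthogonalProjectionOnto_eq_zero_iff, Submodule.orthogonal_orthogonal]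
    ext y
    constructor
    · rintro ⟨q, rfl⟩
      exact ⟨⟨q, rfl⟩, (hmem _).2 (hall q)⟩
    · rintro ⟨⟨q, hq⟩, hy⟩
      refine ⟨q, ?_⟩
      have h1 := (hmem y).1 hy
      rw [← E.starProjection_add_starProjection_orthogonal (F q),
        ← E.starProjection_add_starProjection_orthogonal y]
      simp only [Submodule.starProjection_apply]
      simp only at hq
      rw [hq, hall q, h1]

/-- A submanifold is affine as soon as all its local graph functions have vanishing Hessian. -/
theorem isAffineLinear_of_fderiv_fderiv_eq_zero (hF : IsSmoothImmersion n F)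
    (hE : finrank ℝ E = n) (hT : ∀ p, tangentPlane n F p ⊓ Eᗮ = ⊥)
    (h : ∀ (ψ : E → M) (x : E), (∀ᶠ y in 𝓝 x, IsGraphChart F E ψ y) →
      fderiv ℝ (fderiv ℝ (graphFun F E ψ)) x = 0) : IsAffineLinear n F := by
  have hloc : IsLocallyConstant (tangentPlane n F) := by
    rw [IsLocallyConstant.iff_eventually_eq]
    intro p
    obtain ⟨ψ, hψ, hc⟩ := exists_isGraphChart hF hE p (hT p)
    have h1 := eventually_eq_of_fderiv_eq_zero (Y := E →L[ℝ] Eᗮ) (f := fderiv ℝ (graphFun F E ψ))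
      (hc.mono fun y hy => (hy.contDiffAt_graphFun.of_le
        (by norm_num : (2 : ℕ∞ω) ≤ 3)).differentiableAt_fderiv)
      (hc.eventually_nhds.mono fun y hy => h ψ y hy)
    have hcont : Tendsto (fun q => E.orthogonalProjectionOnto (F q)) (𝓝 p)
      (𝓝 (E.orthogonalProjectionOnto (F p))) :=
      (E.orthogonalProjectionOnto.continuous.comp hF.1.continuous).continuousAt
    have hp := hc.self_of_nhds
    have hinv := hp.left_inv
    rw [hψ] at hinv
    filter_upwards [hinv, hcont.eventually (h1.and hc)] with q hq hq1
    have h2 := hq1.2.tangentPlane_eq hF hE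
    have h3 := hp.tangentPlane_eq hF hE
    rw [hq, hq1.1] at h2
    rw [hψ] at h3
    rw [h2, h3]
  obtain ⟨p₀⟩ : Nonempty M := inferInstance
  exact isAffineLinear_of_tangentPlane_eq hF (E := tangentPlane n F p₀) fun p =>
    hloc.apply_eq_of_isPreconnected isPreconnected_univ (Set.mem_univ _) (Set.mem_univ _)

end Affine

/-! ### Rigidity under constant Jordan angles -/

section Cases

variable {n k : ℕ} {M : Type*} [TopologicalSpace M] [ChartedSpace (Euc n) M]
  [ConnectedSpace M] {F : M → Euc k} {E : Submodule ℝ (Euc k)}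
  {θ θ₁ θ₂ : ℝ}

theorem cos_ne_zero_of_mem_jordanAngles {P Q : Submodule ℝ (Euc k)} (h : θ ∈ jordanAngles P Q)
    (hne : θ ≠ Real.pi / 2) : Real.cos θ ≠ 0 :=
  (Real.cos_pos_of_mem_Ioo ⟨by linarith [h.1.1, Real.pi_pos], lt_of_le_of_ne h.1.2 hne⟩).ne'

theorem tan_ne_zero_of_mem_jordanAngles {P Q : Submodule ℝ (Euc k)} (h : θ ∈ jordanAngles P Q)
    (hne : θ ≠ Real.pi / 2) (h0 : θ ≠ 0) : Real.tan θ ≠ 0 :=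
  (Real.tan_pos_of_pos_of_lt_pi_div_two (lt_of_le_of_ne h.1.1 h0.symm)
    (lt_of_le_of_ne h.1.2 hne)).ne'

theorem tan_sq_ne_of_mem_jordanAngles {P Q : Submodule ℝ (Euc k)} (h₁ : θ₁ ∈ jordanAngles P Q)
    (h₂ : θ₂ ∈ jordanAngles P Q) (hne₁ : θ₁ ≠ Real.pi / 2) (hne₂ : θ₂ ≠ Real.pi / 2)
    (h : θ₁ ≠ θ₂) : Real.tan θ₁ ^ 2 ≠ Real.tan θ₂ ^ 2 := by
  have hp := Real.pi_pos
  intro h'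
  have t₁ : 0 ≤ Real.tan θ₁ := Real.tan_nonneg_of_nonneg_of_le_pi_div_two h₁.1.1 h₁.1.2
  have t₂ : 0 ≤ Real.tan θ₂ := Real.tan_nonneg_of_nonneg_of_le_pi_div_two h₂.1.1 h₂.1.2
  refine h (Real.tan_inj_of_lt_of_lt_pi_div_two ?_ ?_ ?_ ?_ ((sq_eq_sq₀ t₁ t₂).1 h'))
  · linarith [h₁.1.1]
  · exact lt_of_le_of_ne h₁.1.2 hne₁
  · linarith [h₂.1.1]
  · exact lt_of_le_of_ne h₂.1.2 hne₂

theorem surjective_of_injective (hE : finrank ℝ E = n) (hk : k = n + n) {A : E →L[ℝ] Eᗮ}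
    (hA : ∀ v, A v = 0 → v = 0) : Function.Surjective A := by
  have h1 := E.finrank_add_finrank_orthogonal
  rw [finrank_euclideanSpace_fin] at h1
  have h2 : Function.Injective A.toLinearMap := by
    rw [← LinearMap.ker_eq_bot, LinearMap.ker_eq_bot']
    exact hA
  exact (LinearMap.injective_iff_surjective_of_finrank_eq_finrank (by omega)).1 h2

theorem inf_orthogonal_eq_bot_of_pi_div_two_notMem {P Q : Submodule ℝ (Euc k)}
    (h : Real.pi / 2 ∉ jordanAngles P Q) : P ⊓ Qᗮ = ⊥ := by
  rwa [pi_div_two_mem_jordanAngles, not_not] at h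

/-- A graph over `E` of a local similarity between spaces of the same dimension is affine. -/
theorem isAffineLinear_of_one_tangent_angle_of_equidim (hF : IsSmoothImmersion n F)
    (hE : finrank ℝ E = n) (hk : k = n + n) (hθ : θ ≠ Real.pi / 2) (hθ0 : θ ≠ 0)
    (h : ∀ p, jordanAngles (tangentPlane n F p) E = {θ}) : IsAffineLinear n F := by
  refine isAffineLinear_of_fderiv_fderiv_eq_zero hF hE
    (fun p => inf_orthogonal_eq_bot_of_pi_div_two_notMem (by rw [h p]; exact fun h' => hθ h'.symm))
    fun ψ x hc => ?_
  have hmem : θ ∈ jordanAngles (tangentPlane n F (ψ x)) E := by rw [h]; rfl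
  have hcos := cos_ne_zero_of_mem_jordanAngles hmem hθ
  have htan := tan_ne_zero_of_mem_jordanAngles hmem hθ hθ0
  have hiso : ∀ᶠ y in 𝓝 x, ∀ v w, ⟪fderiv ℝ (graphFun F E ψ) y v,
      fderiv ℝ (graphFun F E ψ) y w⟫_ℝ = Real.tan θ ^ 2 * ⟪v, w⟫_ℝ := by
    filter_upwards [hc] with y hy
    exact isometric_of_jordanAngles hcos (by rw [← hy.tangentPlane_eq hF hE, h])
  refine fderiv_fderiv_eq_zero_of_isometric_of_surjective
    (hc.self_of_nhds.contDiffAt_graphFun.of_le (by norm_num)) hiso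
    (surjective_of_injective hE hk fun v hv => ?_)
  have h1 := hiso.self_of_nhds v v
  rw [hv, inner_zero_left] at h1
  exact inner_self_eq_zero.1 ((mul_eq_zero.1 h1.symm).resolve_left (pow_ne_zero 2 htan))

/-- One tangential angle: `A† A = tan² θ`. -/
theorem isAffineLinear_of_one_tangent_angle (hF : IsSmoothImmersion n F) (hE : finrank ℝ E = n)
    (hθ : θ ≠ Real.pi / 2) (h : ∀ p, jordanAngles (tangentPlane n F p) E = {θ})
    (hH : HasParallelMeanCurvature n F) : IsAffineLinear n F := by
  refine isAffineLinear_of_fderiv_fderiv_eq_zero hF hE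
    (fun p => inf_orthogonal_eq_bot_of_pi_div_two_notMem (by rw [h p]; exact fun h' => hθ h'.symm))
    fun ψ x hc => ?_
  have hcos := cos_ne_zero_of_mem_jordanAngles (by rw [h (ψ x)]; rfl) hθ
  set μ := Real.tan θ ^ 2 with hμ
  have hμ0 : 0 ≤ μ := sq_nonneg _
  have hμ1 : (1 + μ)⁻¹ ≠ 0 := by positivity
  set f := graphFun F E ψ with hf
  have hiso : ∀ᶠ y in 𝓝 x, ∀ v w, ⟪fderiv ℝ f y v, fderiv ℝ f y w⟫_ℝ = μ * ⟪v, w⟫_ℝ := by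
    filter_upwards [hc] with y hy
    exact isometric_of_jordanAngles hcos (by rw [← hy.tangentPlane_eq hF hE, h])
  have hfx := hc.self_of_nhds.contDiffAt_graphFun
  let ε := stdOrthonormalBasis ℝ E
  refine fderiv_fderiv_eq_zero_of_isometric ε hfx hiso ?_
  -- the Hessian is normal, so that `H` is a multiple of the Laplacian of `f`
  have hHψ : meanCurvature n F ∘ ψ =ᶠ[𝓝 x]
      fun y => (1 + μ)⁻¹ • ((basisLaplacian ε f y : Eᗮ) : Euc k) := by
    filter_upwards [hc.eventually_nhds, hiso.eventually_nhds] with y hy hi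
    have hfy := hy.self_of_nhds.contDiffAt_graphFun
    have hD : ∀ v, gramOp (fderiv ℝ f y) v = μ • v := fun v =>
      ext_inner_right ℝ fun w => by
        rw [inner_gramOp_left, hi.self_of_nhds, Submodule.inner_smul_left']
    rw [Function.comp_apply, meanCurvature_eq ε hy hF hE
      (S := (1 + μ)⁻¹ • ContinuousLinearMap.id ℝ E) (fun v => by
        change (1 + μ)⁻¹ • v + gramOp (fderiv ℝ f y) ((1 + μ)⁻¹ • v) = v
        have : 1 + μ ≠ 0 := by positivity
        rw [hD]
        match_scalars
        field_simp)]
    have h1 : ∑ j, fderiv ℝ (fderiv ℝ f) y (((1 + μ)⁻¹ • ContinuousLinearMap.id ℝ E) (ε j)) (ε j) =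
        (1 + μ)⁻¹ • basisLaplacian ε f y := by
      simp [basisLaplacian, Finset.smul_sum]
    rw [← hf, h1, Submodule.coe_smul, map_smul]
    congr 1
    rw [Submodule.starProjection_eq_self_iff, Submodule.mem_orthogonal']
    rintro _ ⟨w, rfl⟩
    change ⟪_, graphMap _ w⟫_ℝ = 0
    rw [inner_coe_orthogonal_graphMap, basisLaplacian, sum_inner]
    exact Finset.sum_eq_zero fun j _ =>
      inner_fderiv_fderiv_of_isometric (hfy.of_le (by norm_num)) hi _ _ _
  have hd : HasFDerivAt (fun y => (1 + μ)⁻¹ • ((basisLaplacian ε f y : Eᗮ) : Euc k))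
      ((1 + μ)⁻¹ • (Eᗮ.subtypeL ∘L fderiv ℝ (basisLaplacian ε f) x)) x :=
    (Eᗮ.subtypeL.hasFDerivAt.comp x
      (differentiableAt_basisLaplacian ε hfx).hasFDerivAt).fun_const_smul _
  ext1 w
  have h1 := starProjection_fderiv_meanCurvature_eq_zero hc.self_of_nhds hF hE hH
    (hd.congr_of_eventuallyEq hHψ) w
  rw [smul_apply, map_smul] at h1
  exact eq_zero_of_starProjection_orthogonal_graphPlane _ ((smul_eq_zero.1 h1).resolve_left hμ1)

theorem starProjection_orthogonal_graphPlane_of_coisometric {A : E →L[ℝ] Eᗮ} {μ : ℝ} (hμ : 0 ≤ μ)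
    (h : ∀ a b, ⟪ContinuousLinearMap.adjoint A a, ContinuousLinearMap.adjoint A b⟫_ℝ = μ * ⟪a, b⟫_ℝ)
    (z : Eᗮ) : (graphPlane A)ᗮ.starProjection (z : Euc k) =
      (1 + μ)⁻¹ • ((z : Euc k) - (ContinuousLinearMap.adjoint A z : E)) := by
  have hA : A (ContinuousLinearMap.adjoint A z) = μ • z := ext_inner_right ℝ fun w => by
    rw [← ContinuousLinearMap.adjoint_inner_right, h, real_inner_smul_left]
  refine Submodule.eq_starProjection_of_mem_of_inner_eq_zero
    (Submodule.smul_mem _ _ (sub_adjoint_mem_orthogonal_graphPlane A z)) fun b hb => ?_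
  have h1 : (z : Euc k) - (1 + μ)⁻¹ • ((z : Euc k) - (ContinuousLinearMap.adjoint A z : E)) =
      (1 + μ)⁻¹ • graphMap A (ContinuousLinearMap.adjoint A z) := by
    rw [graphMap_apply, hA, Submodule.coe_smul]
    have : 1 + μ ≠ 0 := by positivity
    match_scalars <;> field_simp
    ring
  rw [h1, real_inner_smul_left, hb _ (graphMap_mem A _), mul_zero]

set_option maxHeartbeats 1000000 in
/-- One normal angle: `A A† = tan² θ`. -/
theorem isAffineLinear_of_one_normal_angle (hF : IsSmoothImmersion n F) (hE : finrank ℝ E = n)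
    (hθ : θ ≠ Real.pi / 2) (h : ∀ p, jordanAngles (normalPlane n F p) Eᗮ = {θ})
    (hH : HasParallelMeanCurvature n F) : IsAffineLinear n F := by
  refine isAffineLinear_of_fderiv_fderiv_eq_zero hF hE (fun p => ?_) fun ψ x hc => ?_
  · have h1 := inf_orthogonal_eq_bot_of_pi_div_two_notMem
      (P := normalPlane n F p) (Q := Eᗮ) (by rw [h p]; exact fun h' => hθ h'.symm)
    have h2 := finrank_orthogonal_inf_orthogonal (tangentPlane n F p) Eᗮ
    have h3 := E.finrank_add_finrank_orthogonal
    rw [finrank_euclideanSpace_fin] at h3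
    change finrank ℝ (normalPlane n F p ⊓ Eᗮᗮ : Submodule ℝ (Euc k)) + _ + _ = _ at h2
    rw [h1, finrank_bot, finrank_tangentPlane hF] at h2
    exact Submodule.finrank_eq_zero.1 (by omega)
  have hcos := cos_ne_zero_of_mem_jordanAngles (by rw [h (ψ x)]; rfl) hθ
  set μ := Real.tan θ ^ 2 with hμ
  have hμ0 : 0 ≤ μ := sq_nonneg _
  have hμ1 : (1 + μ)⁻¹ ≠ 0 := by positivity
  set f := graphFun F E ψ with hf
  have hiso : ∀ᶠ y in 𝓝 x, ∀ a b, ⟪ContinuousLinearMap.adjoint (fderiv ℝ f y) a,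
      ContinuousLinearMap.adjoint (fderiv ℝ f y) b⟫_ℝ = μ * ⟪a, b⟫_ℝ := by
    filter_upwards [hc] with y hy
    refine coisometric_of_jordanAngles hcos ?_
    rw [← hy.tangentPlane_eq hF hE]
    exact h _
  have hfx := hc.self_of_nhds.contDiffAt_graphFun
  let ε := stdOrthonormalBasis ℝ E
  let η := stdOrthonormalBasis ℝ Eᗮ
  -- the Hessian has no trace over the range of `A†`, so that `H` is determined by the Laplacian
  have hHψ : meanCurvature n F ∘ ψ =ᶠ[𝓝 x] fun y => (1 + μ)⁻¹ •
      (((basisLaplacian ε f y : Eᗮ) : Euc k) -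
        (ContinuousLinearMap.adjoint (fderiv ℝ f y) (basisLaplacian ε f y) : E)) := by
    filter_upwards [hc.eventually_nhds, hiso.eventually_nhds] with y hy hi
    have hfy := hy.self_of_nhds.contDiffAt_graphFun
    set A := fderiv ℝ f y with hA
    have hAA : ∀ z, A (ContinuousLinearMap.adjoint A z) = μ • z := fun z =>
      ext_inner_right ℝ fun w => by
        rw [← ContinuousLinearMap.adjoint_inner_right, hi.self_of_nhds, real_inner_smul_left]
    have hDD : ∀ v, gramOp A (gramOp A v) = μ • gramOp A v := fun v => by
      change ContinuousLinearMap.adjoint A (A (ContinuousLinearMap.adjoint A (A v))) = _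
      rw [hAA, map_smul]
      rfl
    rw [Function.comp_apply, meanCurvature_eq ε hy hF hE
      (S := ContinuousLinearMap.id ℝ E - (1 + μ)⁻¹ • gramOp A) (fun v => by
        change v - (1 + μ)⁻¹ • gramOp A v + gramOp A (v - (1 + μ)⁻¹ • gramOp A v) = v
        have : 1 + μ ≠ 0 := by positivity
        rw [map_sub, map_smul, hDD]
        match_scalars <;> field_simp
        ring)]
    have h2 : ∑ j, fderiv ℝ (fderiv ℝ f) y (gramOp A (ε j)) (ε j) = 0 := by
      have := sum_bilin_map_orthonormalBasis (fderiv ℝ (fderiv ℝ f) y)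
        (ContinuousLinearMap.adjoint A) η ε
      rw [ContinuousLinearMap.adjoint_adjoint] at this
      refine this.symm.trans (Finset.sum_eq_zero fun a _ => ?_)
      exact fderiv_fderiv_adjoint_adjoint_eq_zero (hfy.of_le (by norm_num)) hi _ _
    have h1 : ∑ j, fderiv ℝ (fderiv ℝ f) y ((ContinuousLinearMap.id ℝ E -
        (1 + μ)⁻¹ • gramOp A) (ε j)) (ε j) = basisLaplacian ε f y := by
      simp only [sub_apply, ContinuousLinearMap.id_apply, smul_apply, map_sub, map_smul,
        Finset.sum_sub_distrib, ← Finset.smul_sum, h2, smul_zero, sub_zero]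
      rfl
    rw [← hf, h1, ← hA]
    exact starProjection_orthogonal_graphPlane_of_coisometric hμ0 hi.self_of_nhds _
  have hd := ((Eᗮ.subtypeL.hasFDerivAt.comp x
    (differentiableAt_basisLaplacian ε hfx).hasFDerivAt).fun_sub (E.subtypeL.hasFDerivAt.comp x
      (hasFDerivAt_adjoint_basisLaplacian ε hfx))).fun_const_smul (1 + μ)⁻¹
  refine fderiv_fderiv_eq_zero_of_coisometric ε η hμ0 hfx hiso fun w b => ?_
  have h1 := starProjection_fderiv_meanCurvature_eq_zero hc.self_of_nhds hF hE hH
    (hd.congr_of_eventuallyEq hHψ) w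
  rw [smul_apply, map_smul] at h1
  have h2 := (smul_eq_zero.1 h1).resolve_left hμ1
  set A := fderiv ℝ f x with hA
  set L' := fderiv ℝ (basisLaplacian ε f) x w with hL'
  set B := fderiv ℝ (fderiv ℝ f) x w with hB
  set v : E := ContinuousLinearMap.adjoint A L' +
    ContinuousLinearMap.adjoint B (basisLaplacian ε f x) with hv
  have h3 : (graphPlane A)ᗮ.starProjection ((L' : Euc k) - (v : Euc k)) = 0 := h2
  have h4 := congrArg (fun u => ⟪u, (b : Euc k) - (ContinuousLinearMap.adjoint A b : E)⟫_ℝ) h3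
  simp only [Submodule.inner_starProjection_left_eq_right, inner_zero_left,
    Submodule.starProjection_eq_self_iff.2 (sub_adjoint_mem_orthogonal_graphPlane A b)] at h4
  rw [inner_sub_left, inner_sub_right, inner_sub_right, inner_coe_coe_orthogonal, real_inner_comm,
    real_inner_comm _ (L' : Euc k), inner_coe_coe_orthogonal, sub_zero, zero_sub, sub_neg_eq_add,
    ← Submodule.coe_inner, ← Submodule.coe_inner, hv, inner_add_left, hiso.self_of_nhds,
    ContinuousLinearMap.adjoint_inner_left, real_inner_comm] at h4
  linarith

/-- Two tangential angles: in the first alternative of `h0` the differential of the graph function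
has a kernel, in the second one it is bijective. -/
theorem isAffineLinear_of_two_angles (hF : IsSmoothImmersion n F) (hE : finrank ℝ E = n)
    (hθ₁ : θ₁ ≠ Real.pi / 2) (hθ₂ : θ₂ ≠ Real.pi / 2) (hne : θ₁ ≠ θ₂)
    (h : ∀ p, jordanAngles (tangentPlane n F p) E = {θ₁, θ₂})
    (h0 : θ₁ = 0 ∨ k = n + n ∧ θ₁ ≠ 0 ∧ θ₂ ≠ 0)
    (hH : IsMinimalSubmanifold n F) : IsAffineLinear n F := by
  refine isAffineLinear_of_fderiv_fderiv_eq_zero hF hE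
    (fun p => inf_orthogonal_eq_bot_of_pi_div_two_notMem (by
      rw [h p]
      rintro (h' | h')
      · exact hθ₁ h'.symm
      · exact hθ₂ h'.symm)) fun ψ x hc => ?_
  have hmem₁ : θ₁ ∈ jordanAngles (tangentPlane n F (ψ x)) E := by rw [h]; exact Or.inl rfl
  have hmem₂ : θ₂ ∈ jordanAngles (tangentPlane n F (ψ x)) E := by rw [h]; exact Or.inr rfl
  have hg : ∀ᶠ y in 𝓝 x, HasGramValues (fderiv ℝ (graphFun F E ψ) y)
      (Real.tan θ₁ ^ 2) (Real.tan θ₂ ^ 2) := by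
    filter_upwards [hc] with y hy
    exact hasGramValues_of_jordanAngles (cos_ne_zero_of_mem_jordanAngles hmem₁ hθ₁)
      (cos_ne_zero_of_mem_jordanAngles hmem₂ hθ₂) (by rw [← hy.tangentPlane_eq hF hE, h])
  refine fderiv_fderiv_eq_zero_of_hasGramValues (stdOrthonormalBasis ℝ E)
    (tan_sq_ne_of_mem_jordanAngles hmem₁ hmem₂ hθ₁ hθ₂ hne) (sq_nonneg _) (sq_nonneg _)
    hc.self_of_nhds.contDiffAt_graphFun hg ?_ ?_
  · filter_upwards [hg] with y hy
    rcases h0 with h0 | ⟨hk, h1, h2⟩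
    · right; simp [h0]
    · left
      refine surjective_of_injective hE hk fun v hv => ?_
      have h3 : gramOp (fderiv ℝ (graphFun F E ψ) y) v = 0 := by simp [gramOp, hv]
      have h4 := hy v
      rw [h3, map_zero, smul_zero, zero_sub, eq_comm, neg_eq_zero] at h4
      have t₁ := tan_ne_zero_of_mem_jordanAngles hmem₁ hθ₁ h1
      have t₂ := tan_ne_zero_of_mem_jordanAngles hmem₂ hθ₂ h2
      exact (smul_eq_zero.1 h4).resolve_left (by positivity)
  · filter_upwards [hc.eventually_nhds] with y hy S hS
    have h1 := meanCurvature_eq (stdOrthonormalBasis ℝ E) hy hF hE hS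
    rw [hH] at h1
    exact eq_zero_of_starProjection_orthogonal_graphPlane _ h1.symm

end Cases

/-! ### Submanifolds with constant Jordan angles -/

section CJA

variable {n m : ℕ} {M : Type*} [TopologicalSpace M] [ChartedSpace (Euc n) M]
  {F : M → Euc (n + m)} {Q : Submodule ℝ (Euc (n + m))}

theorem finrank_orthogonal_of_finrank_eq (hQ : finrank ℝ Q = m) : finrank ℝ Qᗮ = n := by
  have h := Q.finrank_add_finrank_orthogonal
  rw [finrank_euclideanSpace_fin] at h
  omega

theorem finrank_normalPlane (hF : IsSmoothImmersion n F) (p : M) :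
    finrank ℝ (normalPlane n F p) = m := by
  have h := (tangentPlane n F p).finrank_add_finrank_orthogonal
  rw [finrank_euclideanSpace_fin, finrank_tangentPlane hF] at h
  change finrank ℝ (tangentPlane n F p)ᗮ = m
  omega

/-- `dim (N ∩ Q) + n = m + dim (T ∩ Qᗮ)`. -/
theorem finrank_normalPlane_inf (hF : IsSmoothImmersion n F) (hQ : finrank ℝ Q = m) (p : M) :
    finrank ℝ (normalPlane n F p ⊓ Q : Submodule ℝ (Euc (n + m))) + n =
      m + finrank ℝ (tangentPlane n F p ⊓ Qᗮ : Submodule ℝ (Euc (n + m))) := by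
  have h := finrank_orthogonal_inf_orthogonal (tangentPlane n F p) Qᗮ
  rw [Submodule.orthogonal_orthogonal, finrank_tangentPlane hF,
    finrank_orthogonal_of_finrank_eq hQ] at h
  change finrank ℝ (normalPlane n F p ⊓ Q : Submodule ℝ (Euc (n + m))) + _ + _ = _ at h
  omega

/-- Tangential and normal Jordan angles agree, except possibly for the angle `0`. -/
theorem mem_jordanAngles_tangentPlane_iff (hF : IsSmoothImmersion n F) (hQ : finrank ℝ Q = m)
    (p : M) {θ : ℝ} (hθ : θ ≠ 0) :
    θ ∈ jordanAngles (tangentPlane n F p) Qᗮ ↔ θ ∈ jordanAngles (normalPlane n F p) Q := by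
  constructor
  · intro h
    have := mem_jordanAngles_orthogonal_of_mem
      (by rw [finrank_tangentPlane hF, Submodule.orthogonal_orthogonal, hQ]) hθ h
    rwa [Submodule.orthogonal_orthogonal] at this
  · intro h
    have := mem_jordanAngles_orthogonal_of_mem
      (by rw [finrank_normalPlane hF, finrank_orthogonal_of_finrank_eq hQ, add_comm]) hθ h
    rwa [normalPlane, Submodule.orthogonal_orthogonal] at this

theorem HasCJA.jordanAngles_tangentPlane_eq (h : HasCJA n F Q) (hF : IsSmoothImmersion n F)
    (hQ : finrank ℝ Q = m) (p q : M) :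
    jordanAngles (tangentPlane n F p) Qᗮ = jordanAngles (tangentPlane n F q) Qᗮ := by
  ext θ
  rcases eq_or_ne θ 0 with rfl | hθ
  · -- the multiplicity of the angle `0` is `dim (N ∩ Q)`, which determines `dim (T ∩ Qᗮ)`
    have h1 : finrank ℝ (normalPlane n F p ⊓ Q : Submodule ℝ (Euc (n + m))) =
        finrank ℝ (normalPlane n F q ⊓ Q : Submodule ℝ (Euc (n + m))) := by
      by_cases h0 : (0 : ℝ) ∈ jordanAngles (normalPlane n F p) Q
      · have := (h p q).2 0 h0
        rwa [jordanMultiplicity, jordanMultiplicity, angleSpace_zero, angleSpace_zero] at this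
      · have h0' := h0
        rw [(h p q).1] at h0'
        rw [zero_mem_jordanAngles, not_not] at h0 h0'
        rw [h0, h0']
    have hp := finrank_normalPlane_inf hF hQ p
    have hq := finrank_normalPlane_inf hF hQ q
    rw [zero_mem_jordanAngles, zero_mem_jordanAngles, ne_eq, ne_eq, ← Submodule.finrank_eq_zero,
      ← Submodule.finrank_eq_zero]
    omega
  · rw [mem_jordanAngles_tangentPlane_iff hF hQ p hθ, mem_jordanAngles_tangentPlane_iff hF hQ q hθ,
      (h p q).1]

theorem HasCJA.argN_eq (h : HasCJA n F Q) (p : M) :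
    argN n F Q = jordanAngles (normalPlane n F p) Q := by
  ext θ
  exact ⟨fun hθ => hθ p, fun hθ q => by rwa [(h q p).1]⟩

theorem HasCJA.argT_eq (h : HasCJA n F Q) (hF : IsSmoothImmersion n F) (hQ : finrank ℝ Q = m)
    (p : M) : argT n F Q = jordanAngles (tangentPlane n F p) Qᗮ := by
  ext θ
  exact ⟨fun hθ => hθ p, fun hθ q => by rwa [h.jordanAngles_tangentPlane_eq hF hQ q p]⟩

theorem HasCJA.mem_argT_iff [Nonempty M] (h : HasCJA n F Q) (hF : IsSmoothImmersion n F)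
    (hQ : finrank ℝ Q = m) {θ : ℝ} (hθ : θ ≠ 0) : θ ∈ argT n F Q ↔ θ ∈ argN n F Q := by
  obtain ⟨p⟩ := ‹Nonempty M›
  rw [h.argT_eq hF hQ p, h.argN_eq p, mem_jordanAngles_tangentPlane_iff hF hQ p hθ]

theorem HasCJA.eq_of_zero_notMem [Nonempty M] (h : HasCJA n F Q) (hF : IsSmoothImmersion n F)
    (hQ : finrank ℝ Q = m) (hT : (0 : ℝ) ∉ argT n F Q) (hN : (0 : ℝ) ∉ argN n F Q) : m = n := by
  obtain ⟨p⟩ := ‹Nonempty M›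
  rw [h.argT_eq hF hQ p, zero_mem_jordanAngles, not_not] at hT
  rw [h.argN_eq p, zero_mem_jordanAngles, not_not] at hN
  have := finrank_normalPlane_inf hF hQ p
  rw [hT, hN, finrank_bot] at this
  omega

variable [ConnectedSpace M]

theorem HasCJA.isAffineLinear_of_one_one (h : HasCJA n F Q) (hF : IsSmoothImmersion n F)
    (hQ : finrank ℝ Q = m) (hT : numT n F Q = 1) (hN : numN n F Q = 1) : IsAffineLinear n F := by
  obtain ⟨θ, hθ⟩ := Set.ncard_eq_one.1 hT
  obtain ⟨θ', hθ'⟩ := Set.ncard_eq_one.1 hN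
  have hJ : ∀ p, jordanAngles (tangentPlane n F p) Qᗮ = {θ} := fun p => by
    rw [← h.argT_eq hF hQ p, hθ]
  have hle : ∀ p, tangentPlane n F p ≤ angleSpace (tangentPlane n F p) Qᗮ θ := fun p =>
    le_of_forall_angleSpace_le (Q := Qᗮ) fun t ht => by
      rw [hJ p] at ht
      obtain rfl : t = θ := ht
      exact le_rfl
  rcases eq_or_ne θ 0 with rfl | h0
  · refine isAffineLinear_of_tangentPlane_eq hF (E := Qᗮ) fun p => ?_
    have h1 := hle p
    rw [angleSpace_zero, le_inf_iff] at h1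
    exact Submodule.eq_of_le_of_finrank_eq h1.2
      (by rw [finrank_tangentPlane hF, finrank_orthogonal_of_finrank_eq hQ])
  · have hθN : θ ∈ argN n F Q := (h.mem_argT_iff hF hQ h0).1 (by rw [hθ]; rfl)
    have hmn : m = n := h.eq_of_zero_notMem hF hQ (by rw [hθ]; exact fun h' => h0 h'.symm) (by
      rw [hθ'] at hθN ⊢
      obtain rfl : θ = θ' := hθN
      exact fun h' => h0 h'.symm)
    rcases eq_or_ne θ (Real.pi / 2) with rfl | h2
    · refine isAffineLinear_of_tangentPlane_eq hF (E := Q) fun p => ?_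
      have h1 := hle p
      rw [angleSpace_pi_div_two, Submodule.orthogonal_orthogonal, le_inf_iff] at h1
      exact Submodule.eq_of_le_of_finrank_eq h1.2 (by rw [finrank_tangentPlane hF, hQ, hmn])
    · exact isAffineLinear_of_one_tangent_angle_of_equidim hF (finrank_orthogonal_of_finrank_eq hQ)
        (by omega) h2 h0 hJ

theorem HasCJA.isAffineLinear_of_two_two (h : HasCJA n F Q) (hF : IsSmoothImmersion n F)
    (hQ : finrank ℝ Q = m) (hT : numT n F Q = 2) (hN : numN n F Q = 2)
    (hne : argN n F Q ≠ {0, Real.pi / 2}) (hH : IsMinimalSubmanifold n F) :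
    IsAffineLinear n F := by
  have hJ := fun p => h.argT_eq hF hQ p
  have hTN := fun θ (hθ : θ ≠ 0) => h.mem_argT_iff hF hQ (θ := θ) hθ
  by_cases h0 : (0 : ℝ) ∈ argN n F Q
  · obtain ⟨θ, hθ0, hθ⟩ : ∃ θ, θ ≠ 0 ∧ argN n F Q = {0, θ} := by
      obtain ⟨c, d, hcd, hs⟩ := Set.ncard_eq_two.1 hN
      rw [hs] at h0
      rcases h0 with rfl | h0
      · exact ⟨d, hcd.symm, hs⟩
      · obtain rfl : (0 : ℝ) = d := h0
        exact ⟨c, hcd, hs.trans (Set.pair_comm _ _)⟩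
    have hT' : argT n F Q = {0, θ} := by
      refine Set.eq_of_subset_of_ncard_le (fun t ht => ?_) ?_ (Set.toFinite _)
      · by_cases ht0 : t = 0
        · exact Or.inl ht0
        · rw [← hθ]; exact (hTN t ht0).1 ht
      · rw [Set.ncard_pair hθ0.symm]
        exact hT.ge
    refine isAffineLinear_of_two_angles hF (finrank_orthogonal_of_finrank_eq hQ)
      (θ₁ := 0) (θ₂ := θ) (by positivity) ?_ hθ0.symm (fun p => by rw [← hJ p, hT']) (Or.inl rfl) hH
    rintro rfl
    exact hne hθ
  · -- all angles are nonzero, so that `m = n` and `M` is a graph over `Q` as well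
    have hs : argN n F Q = argT n F Q := by
      refine Set.eq_of_subset_of_ncard_le (fun t ht => ?_) ?_
        (Set.finite_of_ncard_ne_zero (by rw [show (argT n F Q).ncard = 2 from hT]; norm_num))
      · exact (hTN t fun h' => h0 (h' ▸ ht)).2 ht
      · exact hT.le.trans hN.ge
    have hmn : m = n := h.eq_of_zero_notMem hF hQ (hs ▸ h0) h0
    obtain ⟨c, d, hcd, hs'⟩ := Set.ncard_eq_two.1 hT
    have hc0 : c ≠ 0 := by
      rintro rfl
      exact h0 (by rw [hs, hs']; exact Or.inl rfl)
    have hd0 : d ≠ 0 := by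
      rintro rfl
      exact h0 (by rw [hs, hs']; exact Or.inr rfl)
    have hJQ : ∀ p, jordanAngles (tangentPlane n F p) Q =
        {Real.pi / 2 - c, Real.pi / 2 - d} := by
      intro p
      have h1 := jordanAngles_orthogonal (P := tangentPlane n F p) (Q := Qᗮ)
      rw [Submodule.orthogonal_orthogonal, ← hJ p, hs'] at h1
      rw [h1]
      ext t
      simp only [Set.mem_preimage, Set.mem_insert_iff, Set.mem_singleton_iff]
      constructor <;> rintro (h' | h') <;> [left; right; left; right] <;> linarith
    have hc1 : Real.pi / 2 - c ≠ Real.pi / 2 := by simpa using hc0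
    have hd1 : Real.pi / 2 - d ≠ Real.pi / 2 := by simpa using hd0
    have hcd1 : Real.pi / 2 - c ≠ Real.pi / 2 - d := by simpa using hcd
    by_cases hd2 : Real.pi / 2 - d = 0
    · exact isAffineLinear_of_two_angles hF (hQ.trans hmn) hd1 hc1 hcd1.symm
        (fun p => (hJQ p).trans (Set.pair_comm _ _)) (Or.inl hd2) hH
    · refine isAffineLinear_of_two_angles hF (hQ.trans hmn) hc1 hd1 hcd1 hJQ ?_ hH
      by_cases hc2 : Real.pi / 2 - c = 0
      · exact Or.inl hc2
      · exact Or.inr ⟨by omega, hc2, hd2⟩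

end CJA

theorem mainTheorem2 {n m : ℕ} {M : Type*} [TopologicalSpace M] [ChartedSpace (Euc n) M]
    [IsManifold (𝓡 n) ∞ M] [ConnectedSpace M] (F : M → Euc (n + m)) (hF : IsSmoothImmersion n F)
    (Q₀ : Submodule ℝ (Euc (n + m))) (hQ₀ : finrank ℝ Q₀ = m) (hCJA : HasCJA n F Q₀) :
    (numT n F Q₀ = 1 → numN n F Q₀ = 1 → IsAffineLinear n F) ∧
    (numT n F Q₀ = 1 → numN n F Q₀ = 2 → Real.pi / 2 ∉ argT n F Q₀ → HasParallelMeanCurvature n F →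
      IsAffineLinear n F) ∧
    (numT n F Q₀ = 2 → numN n F Q₀ = 1 → Real.pi / 2 ∉ argN n F Q₀ → HasParallelMeanCurvature n F →
      IsAffineLinear n F) ∧
    (numT n F Q₀ = 2 → numN n F Q₀ = 2 → argN n F Q₀ ≠ {0, Real.pi / 2} → IsMinimalSubmanifold n F →
      IsAffineLinear n F) := by
  refine ⟨hCJA.isAffineLinear_of_one_one hF hQ₀, fun hT _ hpi hH => ?_, fun _ hN hpi hH => ?_,
    hCJA.isAffineLinear_of_two_two hF hQ₀⟩
  · obtain ⟨θ, hθ⟩ := Set.ncard_eq_one.1 hT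
    refine isAffineLinear_of_one_tangent_angle hF (finrank_orthogonal_of_finrank_eq hQ₀) (θ := θ)
      ?_ (fun p => by rw [← hCJA.argT_eq hF hQ₀ p, hθ]) hH
    rintro rfl
    exact hpi (by rw [hθ]; rfl)
  · obtain ⟨θ, hθ⟩ := Set.ncard_eq_one.1 hN
    refine isAffineLinear_of_one_normal_angle hF (finrank_orthogonal_of_finrank_eq hQ₀) (θ := θ)
      ?_ (fun p => by rw [Submodule.orthogonal_orthogonal, ← hCJA.argN_eq p, hθ]) hH
    rintro rfl
    exact hpi (by rw [hθ]; rfl)
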